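/- Let $E$ be a metric space with its Borel $\sigma$-algebra and let $\mu$ be a $\sigma$-finite Borel measure on $E$. Let $L_2(E,\mu)$ be the complex Hilbert space of square-integrable functions, and let $L_{2,\mathrm{loc}}(E,\mu)$ be the space of (classes of) measurable functions $f:E\to\mathbb C$ that are square-integrable over every bounded Borel set. Write $\chi_A$ for the characteristic function of $A$, and also for the operator of multiplication by it. Let $\mathscr I_1(E,\mu)$ be the ideal of trace class operators on $L_2(E,\mu)$, with trace norm $\|\cdot\|_{\mathscr I_1}$, and let $\mathscr I_{1,\mathrm{loc}}(E,\mu)$ be the space of bounded operators $K$ on $L_2(E,\mu)$ such that $\chi_BK\chi_B\in\mathscr I_1(E,\mu)$ for every bounded Borel set $B\subset E$. We say that $K_n\to K$ in $\mathscr I_{1,\mathrm{loc}}(E,\mu)$ if all $K_n$ and $K$ belong to $\mathscr I_{1,\mathrm{loc}}(E,\mu)$ and $\|\chi_B(K_n-K)\chi_B\|_{\mathscr I_1}\to0$ for every bounded Borel set $B$. The angle $\angle(H_1,H_2)$ between two subspaces of $L_2(E,\mu)$ is the infimum of the angles $\arccos\frac{|\langle u,v\rangle|}{\|u\|\,\|v\|}$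 over all nonzero $u\in H_1$, $v\in H_2$ (and $+\infty$ if one of the subspaces is zero). Let $L\subset L_2(E,\mu)$ be a closed subspace such that the operator $Q$ of orthogonal projection onto $L$ belongs to $\mathscr I_{1,\mathrm{loc}}(E,\mu)$, let $V\subset L_{2,\mathrm{loc}}(E,\mu)$ be a finite-dimensional subspace, and let $E_0\subset E$ be a Borel set. Assume that * (a) $\chi_{E\setminus E_0}Q\chi_{E\setminus E_0}\in\mathscr I_1(E,\mu)$; * (b) $\chi_{E_0}V\subset L_2(E,\mu)$; * (c) if $\varphi\in V$ satisfies $\chi_{E_0}\varphi\in\chi_{E_0}L$, then $\varphi=0$; * (d) if $\varphi\in L$ satisfies $\chi_{E_0}\varphi=0$, then $\varphi=0$; and, additionally, that $V\cap L_2(E,\mu)=0$. Set $H=L+V$. **Proposition.** Let $g_n:E\to(0,1]$, $n\in\mathbb N$, be a sequence of measurable functions such that 1. $\sqrt{1-g_n}\,Q\sqrt{1-g_n}\in\mathscr I_1(E,\mu)$ for all $n$; 2. $\sqrt{g_n}\,V\subset L_2(E,\mu)$ for all $n$; 3. there is $\alpha_0>0$ such that $\angle(\sqrt{g_n}\,L,\sqrt{g_n}\,V)\ge\alpha_0$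 for all $n$; 4. for every bounded $B\subset E$ the functions $g_n$ are bounded below on $E_0\cup B$ by a positive constant that does not depend on $n$, and $g_n\to1$ uniformly on $E_0\cup B$ as $n\to\infty$. Then the subspaces $\sqrt{g_n}\,H\subset L_2(E,\mu)$ are closed, and the operators $\Pi^{g_n}$ of orthogonal projection onto $\sqrt{g_n}\,H$ satisfy $\Pi^{g_n}\to Q$ in $\mathscr I_{1,\mathrm{loc}}(E,\mu)$ as $n\to\infty$. **Corollary.** Let $B_1\subset B_2\subset\cdots$ be bounded Borel sets with $\bigcup_nB_n=E\setminus E_0$, and suppose that there is $\alpha_0>0$ such that $\angle(\chi_{E_0\cup B_n}L,\chi_{E_0\cup B_n}V)\ge\alpha_0$ for all $n$. Then the subspaces $\chi_{E_0\cup B_n}H\subset L_2(E,\mu)$ are closed, and the operators $\Pi^{E_0\cup B_n}$ of orthogonal projection onto $\chi_{E_0\cup B_n}H$ satisfy $\Pi^{E_0\cup B_n}\to Q$ in $\mathscr I_{1,\mathrm{loc}}(E,\mu)$ as $n\to\infty$. -/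

import Mathlib

open MeasureTheory Filter Topology
open scoped ENNReal

namespace InfDet

noncomputable section

section TraceClass

variable {𝓗 : Type*} [NormedAddCommGroup 𝓗] [InnerProductSpace ℂ 𝓗]

/-- The trace norm of a bounded operator on a complex Hilbert space, in `[0, ∞]`: the supremum of
`∑ᵢ |⟨T eᵢ, fᵢ⟩|` over all pairs of finite orthonormal families `(eᵢ)`, `(fᵢ)` of the same length.
This is `tr |T|` for every bounded `T`. -/
def traceNorm (T : 𝓗 →L[ℂ] 𝓗) : ℝ≥0∞ :=
  ⨆ (n : ℕ) (e : Fin n → 𝓗) (f : Fin n → 𝓗) (_ : Orthonormal ℂ e) (_ : Orthonormal ℂ f),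
    ∑ i, ‖inner ℂ (T (e i)) (f i)‖ₑ

/-- Trace class operators: operators of finite trace norm. -/
def IsTraceClass (T : 𝓗 →L[ℂ] 𝓗) : Prop := traceNorm T < ∞

/-- The orthogonal projection onto the closure of a subspace (onto the subspace itself, if it is
closed), as a bounded operator of the whole space. -/
def projOnto [CompleteSpace 𝓗] (S : Submodule ℂ 𝓗) : 𝓗 →L[ℂ] 𝓗 :=
  S.topologicalClosure.starProjection

/-- The angle between two subspaces: the infimum of the angles between their nonzero vectors
(so it is `⊤` if one of the subspaces is zero). -/
def subspaceAngle (S T : Submodule ℂ 𝓗) : EReal :=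
  ⨅ (u : 𝓗) (v : 𝓗) (_ : u ∈ S) (_ : v ∈ T) (_ : u ≠ 0) (_ : v ≠ 0),
    ((Real.arccos (‖(inner ℂ u v : ℂ)‖ / (‖u‖ * ‖v‖)) : ℝ) : EReal)

end TraceClass

section Operators

variable {E : Type*} [MeasurableSpace E]

/-- The operator of multiplication by `w` on `L₂(E, μ)`, for a measurable (essentially) bounded
real function `w` (and `0` by convention for other `w`). -/
def mulOp (μ : Measure E) (w : E → ℝ) : Lp ℂ 2 μ →L[ℂ] Lp ℂ 2 μ := by
  classical
  exact if h : MemLp (fun x => (w x : ℂ)) ∞ μ then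
    (ContinuousLinearMap.mul ℂ ℂ).holderL μ ∞ 2 2 (h.toLp _) else 0

theorem coeFn_mulOp {μ : Measure E} {w : E → ℝ} (hw : MemLp (fun x => (w x : ℂ)) ∞ μ)
    (f : Lp ℂ 2 μ) : mulOp μ w f =ᵐ[μ] fun x => (w x : ℂ) * f x := by
  rw [mulOp, dif_pos hw, ContinuousLinearMap.holderL_apply_apply]
  filter_upwards [(ContinuousLinearMap.mul ℂ ℂ).coeFn_holder (r := 2) (hw.toLp _) f,
    hw.coeFn_toLp] with x h1 h2
  rw [h1, h2]
  rfl

/-- The characteristic function of `B`, real-valued. -/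
def chi (B : Set E) : E → ℝ := B.indicator 1

/-- The compression `√w K √w` of a bounded operator `K` on `L₂(E, μ)`. For `w = χ_B` this is
`χ_B K χ_B`. -/
def compress (μ : Measure E) (w : E → ℝ) (K : Lp ℂ 2 μ →L[ℂ] Lp ℂ 2 μ) :
    Lp ℂ 2 μ →L[ℂ] Lp ℂ 2 μ :=
  mulOp μ (fun x => Real.sqrt (w x)) ∘L K ∘L mulOp μ (fun x => Real.sqrt (w x))

/-- The inclusion of `L₂(E, μ)` into the space of all (classes of) measurable functions. -/
def inclL2 (μ : Measure E) : Lp ℂ 2 μ →ₗ[ℂ] (E →ₘ[μ] ℂ) where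
  toFun f := (f : E →ₘ[μ] ℂ)
  map_add' _ _ := rfl
  map_smul' _ _ := rfl

/-- The subspace `√w H` of `L₂(E, μ)` (those `√w h` with `h ∈ H` that lie in `L₂(E, μ)`; all of
them do in the cases of interest). For `w = χ_A` this is `χ_A H`. -/
def sqrtMul {μ : Measure E} (w : E → ℝ) (H : Submodule ℂ (E →ₘ[μ] ℂ)) :
    Submodule ℂ (Lp ℂ 2 μ) where
  carrier := {f | ∃ h ∈ H, f =ᵐ[μ] fun x => (Real.sqrt (w x) : ℂ) * h x}
  zero_mem' := by
    refine ⟨0, H.zero_mem, ?_⟩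
    filter_upwards [AEEqFun.coeFn_zero (α := E) (μ := μ) (β := ℂ)] with x h
    simp [h]
  add_mem' := by
    rintro f₁ f₂ ⟨h₁, m₁, e₁⟩ ⟨h₂, m₂, e₂⟩
    refine ⟨h₁ + h₂, H.add_mem m₁ m₂, ?_⟩
    filter_upwards [e₁, e₂, Lp.coeFn_add f₁ f₂, AEEqFun.coeFn_add h₁ h₂] with x a b c d
    simp only [c, d, Pi.add_apply, a, b, mul_add]
  smul_mem' := by
    rintro c f ⟨h, m, e⟩
    refine ⟨c • h, H.smul_mem c m, ?_⟩
    filter_upwards [e, Lp.coeFn_smul c f, AEEqFun.coeFn_smul c h] with x a b d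
    simp only [b, d, Pi.smul_apply, a, smul_eq_mul]
    ring

end Operators

section Local

variable {E : Type*} [MetricSpace E] [MeasurableSpace E]

/-- The operators `K` on `L₂(E, μ)` that are locally of trace class: `χ_B K χ_B` is of trace class
for every bounded Borel set `B`. -/
def IsLocTraceClass {μ : Measure E} (K : Lp ℂ 2 μ →L[ℂ] Lp ℂ 2 μ) : Prop :=
  ∀ B : Set E, MeasurableSet B → Bornology.IsBounded B → IsTraceClass (compress μ (chi B) K)

/-- Convergence in the space of locally trace class operators: convergence in each of the
seminorms `K ↦ ‖χ_B K χ_B‖₁`, `B` bounded and Borel. -/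
structure TendstoLocTraceClass {μ : Measure E} (K : ℕ → Lp ℂ 2 μ →L[ℂ] Lp ℂ 2 μ)
    (K₀ : Lp ℂ 2 μ →L[ℂ] Lp ℂ 2 μ) : Prop where
  mem : ∀ n, IsLocTraceClass (K n)
  mem_lim : IsLocTraceClass K₀
  tendsto : ∀ B : Set E, MeasurableSet B → Bornology.IsBounded B →
    Tendsto (fun n => traceNorm (compress μ (chi B) (K n - K₀))) atTop (𝓝 0)

/-- Local square integrability: square integrability over bounded Borel sets. -/
def MemL2loc {μ : Measure E} (f : E →ₘ[μ] ℂ) : Prop :=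
  ∀ B : Set E, MeasurableSet B → Bornology.IsBounded B → MemLp f 2 (μ.restrict B)

/-- The standing assumption on a subspace `L` of `L₂(E, μ)` with orthogonal projection `Q`,
a space `V` of measurable functions, and a subset `E₀` of `E`. -/
structure StandingAssumption {μ : Measure E} (L : Submodule ℂ (Lp ℂ 2 μ))
    (V : Submodule ℂ (E →ₘ[μ] ℂ)) (E₀ : Set E) : Prop where
  measurableSet : MeasurableSet E₀
  isClosed : IsClosed (L : Set (Lp ℂ 2 μ))
  locTraceClass : IsLocTraceClass (projOnto L)
  finiteDimensional : FiniteDimensional ℂ V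
  memL2loc : ∀ v ∈ V, MemL2loc v
  traceClass_compl : IsTraceClass (compress μ (chi E₀ᶜ) (projOnto L))
  memLp_restrict : ∀ v ∈ V, MemLp v 2 (μ.restrict E₀)
  eq_zero_of_mem_V : ∀ v ∈ V, ∀ l ∈ L, (∀ᵐ x ∂μ, x ∈ E₀ → v x = l x) → v = 0
  eq_zero_of_mem_L : ∀ l ∈ L, (∀ᵐ x ∂μ, x ∈ E₀ → l x = 0) → l = 0

end Local

end

end InfDet

/-! Let `m n` be multiplication by `√(g n)`. The projection onto `√(g n) H` splits as the projection
onto `m n L` plus the projection onto a space `W n` of dimension at most `dim V`, the component of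
`√(g n) V` orthogonal to `m n L`. The two summands are treated separately, with trace norms
estimated by products of Hilbert–Schmidt norms.

First summand. The operator `χ_{E₀ᶜ} Q` is Hilbert–Schmidt, hence compact, and by (d) it does not
have eigenvalue 1. So restriction to `E₀` is bounded below on `L`, and so is `m n`, uniformly in
`n`. The projection onto `m n L` is therefore `m Q T Q m` with `T = (1 - Q + Q m² Q)⁻¹` bounded
uniformly in `n`. Since `m n → 1` strongly, `T → 1` strongly. Strongly null bounded operators
composed with the fixed Hilbert–Schmidt operator `Q χ_B` tend to zero in Hilbert–Schmidt norm, which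
gives trace norm convergence to `χ_B Q χ_B` (`tendsto_traceNorm_projOnto_map`).

Second summand. As the rank is bounded, operator norm convergence `χ_B P_{W n} → 0` suffices
(`tendsto_norm_comp_projOnto_orthoPart`). By the angle condition, a bounded vector of `W n` comes
from a bounded `v n ∈ √(g n) V`. Since `V ∩ L₂ = 0`, Fatou's lemma forces the coordinates of `v n`
to zero (`tendsto_coeff_zero`), so `v n` vanishes locally in the limit and is weakly null. Its
projection onto `m n L` then vanishes locally too, by compactness of `χ_B Q`.

The Proposition and the Corollary are both instances of `tendstoLocTraceClass_of_tendsto_one`, whose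
weights may vanish outside `E₀`, as characteristic functions do. -/

namespace InfDet

/-! ### Hilbert–Schmidt operators -/

section HilbertSchmidt

variable {𝓗 : Type*} [NormedAddCommGroup 𝓗] [InnerProductSpace ℂ 𝓗]

theorem norm_enorm_sq {F : Type*} [SeminormedAddCommGroup F] (x : F) :
    ‖x‖ₑ ^ 2 = ENNReal.ofReal (‖x‖ ^ 2) := by
  rw [← ofReal_norm, ENNReal.ofReal_pow (norm_nonneg x)]

theorem tsum_enorm_inner_sq {ι : Type*} (b : HilbertBasis ι ℂ 𝓗) (x : 𝓗) :
    ∑' i, ‖inner ℂ (b i) x‖ₑ ^ 2 = ‖x‖ₑ ^ 2 := by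
  have h := b.hasSum_inner_mul_inner x x
  have h1 : HasSum (fun i => ‖inner ℂ (b i) x‖ ^ 2) (‖x‖ ^ 2) := by
    have h2 := (Complex.hasSum_re h)
    have h3 : (inner ℂ x x : ℂ).re = ‖x‖ ^ 2 := by
      simpa using inner_self_eq_norm_sq (𝕜 := ℂ) x
    rw [h3] at h2
    convert h2 using 2 with i
    rw [← inner_conj_symm x (b i), ← Complex.normSq_eq_conj_mul_self, Complex.ofReal_re,
      Complex.normSq_eq_norm_sq]
  simp_rw [norm_enorm_sq]
  rw [← ENNReal.ofReal_tsum_of_nonneg (fun i => by positivity) h1.summable, h1.tsum_eq]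

theorem sum_enorm_inner_sq_le {ι : Type*} [Fintype ι] {e : ι → 𝓗} (he : Orthonormal ℂ e) (x : 𝓗) :
    ∑ i, ‖inner ℂ (e i) x‖ₑ ^ 2 ≤ ‖x‖ₑ ^ 2 := by
  simp_rw [norm_enorm_sq]
  rw [← ENNReal.ofReal_sum_of_nonneg (fun i _ => by positivity)]
  exact ENNReal.ofReal_le_ofReal (he.sum_inner_products_le x)

theorem enorm_inner_comm (x y : 𝓗) : ‖inner ℂ x y‖ₑ = ‖inner ℂ y x‖ₑ := by
  rw [← ofReal_norm, ← ofReal_norm, norm_inner_symm]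

variable [CompleteSpace 𝓗]

variable (𝓗) in
/-- The index set of a fixed Hilbert basis. -/
def basisIndex : Set 𝓗 := (exists_hilbertBasis ℂ 𝓗).choose

variable (𝓗) in
/-- A fixed Hilbert basis. -/
noncomputable def stdHilbertBasis : HilbertBasis (basisIndex 𝓗) ℂ 𝓗 :=
  (exists_hilbertBasis ℂ 𝓗).choose_spec.choose

/-- The square of the Hilbert–Schmidt norm of a bounded operator. -/
noncomputable def hsSq (Y : 𝓗 →L[ℂ] 𝓗) : ℝ≥0∞ := ∑' i, ‖Y (stdHilbertBasis 𝓗 i)‖ₑ ^ 2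

/-- By Parseval both sides are the double sum of `|⟨c j, Y (b i)⟩|²`. -/
theorem tsum_enorm_sq_eq_adjoint {ι κ : Type*} (b : HilbertBasis ι ℂ 𝓗) (c : HilbertBasis κ ℂ 𝓗)
    (Y : 𝓗 →L[ℂ] 𝓗) : ∑' i, ‖Y (b i)‖ₑ ^ 2 = ∑' j, ‖Y.adjoint (c j)‖ₑ ^ 2 := by
  simp_rw [← tsum_enorm_inner_sq c (Y _), ← tsum_enorm_inner_sq b (Y.adjoint _)]
  rw [ENNReal.tsum_comm]
  refine tsum_congr fun j => tsum_congr fun i => ?_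
  rw [ContinuousLinearMap.adjoint_inner_right, enorm_inner_comm]

theorem hsSq_adjoint (Y : 𝓗 →L[ℂ] 𝓗) : hsSq Y.adjoint = hsSq Y :=
  (tsum_enorm_sq_eq_adjoint _ _ Y).symm

theorem sum_enorm_sq_le_hsSq {ι : Type*} [Fintype ι] {e : ι → 𝓗} (he : Orthonormal ℂ e)
    (Y : 𝓗 →L[ℂ] 𝓗) : ∑ i, ‖Y (e i)‖ₑ ^ 2 ≤ hsSq Y := by
  rw [← hsSq_adjoint, hsSq]
  simp_rw [← tsum_enorm_inner_sq (stdHilbertBasis 𝓗) (Y _)]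
  rw [← tsum_fintype (L := .unconditional _), ENNReal.tsum_comm]
  refine ENNReal.tsum_le_tsum fun j => ?_
  rw [tsum_fintype]
  refine le_trans (le_of_eq ?_) (sum_enorm_inner_sq_le he _)
  refine Finset.sum_congr rfl fun i _ => ?_
  rw [ContinuousLinearMap.adjoint_inner_right, enorm_inner_comm]

theorem hsSq_le_of_forall_sum_le {Y : 𝓗 →L[ℂ] 𝓗} {C : ℝ≥0∞}
    (h : ∀ (n : ℕ) (e : Fin n → 𝓗), Orthonormal ℂ e → ∑ i, ‖Y (e i)‖ₑ ^ 2 ≤ C) : hsSq Y ≤ C := by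
  rw [hsSq, ENNReal.tsum_eq_iSup_sum]
  refine iSup_le fun s => ?_
  have := h s.card (fun i => stdHilbertBasis 𝓗 (s.equivFin.symm i))
    ((stdHilbertBasis 𝓗).orthonormal.comp _
      (Subtype.val_injective.comp s.equivFin.symm.injective))
  rw [← Finset.sum_coe_sort]
  refine le_trans (le_of_eq ?_) this
  exact (Equiv.sum_comp s.equivFin.symm (fun i : s => ‖Y (stdHilbertBasis 𝓗 i)‖ₑ ^ 2)).symm

theorem hsSq_comp_le_left (A Y : 𝓗 →L[ℂ] 𝓗) : hsSq (A ∘L Y) ≤ ‖A‖ₑ ^ 2 * hsSq Y := by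
  rw [hsSq, hsSq, ← ENNReal.tsum_mul_left]
  refine ENNReal.tsum_le_tsum fun i => ?_
  rw [← mul_pow]
  gcongr
  exact A.le_opENorm _

theorem hsSq_comp_le_right (Y A : 𝓗 →L[ℂ] 𝓗) : hsSq (Y ∘L A) ≤ ‖A‖ₑ ^ 2 * hsSq Y := by
  rw [← hsSq_adjoint, ContinuousLinearMap.adjoint_comp, ← hsSq_adjoint Y]
  refine (hsSq_comp_le_left _ _).trans_eq ?_
  rw [← ofReal_norm, ← ofReal_norm, LinearIsometryEquiv.norm_map]

/-- Expand `Y x` in the basis: each coefficient is `⟨Y† bᵢ, x⟩`, bounded by `‖Y† bᵢ‖ ‖x‖`. -/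
theorem enorm_sq_le_hsSq (Y : 𝓗 →L[ℂ] 𝓗) : ‖Y‖ₑ ^ 2 ≤ hsSq Y := by
  rcases eq_or_ne (hsSq Y) ∞ with h | h
  · rw [h]; exact le_top
  have key (x : 𝓗) : ‖Y x‖ₑ ^ 2 ≤ hsSq Y * ‖x‖ₑ ^ 2 := by
    rw [← tsum_enorm_inner_sq (stdHilbertBasis 𝓗) (Y x), ← hsSq_adjoint, hsSq,
      ← ENNReal.tsum_mul_right]
    refine ENNReal.tsum_le_tsum fun i => ?_
    rw [← mul_pow, ← ContinuousLinearMap.adjoint_inner_left]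
    gcongr
    rw [← ofReal_norm, ← ofReal_norm, ← ofReal_norm, ← ENNReal.ofReal_mul (norm_nonneg _)]
    exact ENNReal.ofReal_le_ofReal (norm_inner_le_norm _ _)
  have h2 : ‖Y‖ ≤ Real.sqrt (hsSq Y).toReal := by
    refine Y.opNorm_le_bound (Real.sqrt_nonneg _) fun x => ?_
    have := ENNReal.toReal_mono (ENNReal.mul_ne_top h (by finiteness)) (key x)
    simp only [ENNReal.toReal_pow, ENNReal.toReal_mul, toReal_enorm] at this
    rw [← Real.sqrt_sq (norm_nonneg x), ← Real.sqrt_mul ENNReal.toReal_nonneg]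
    exact Real.le_sqrt_of_sq_le this
  rw [norm_enorm_sq, ← ENNReal.ofReal_toReal h]
  refine ENNReal.ofReal_le_ofReal ?_
  exact (pow_le_pow_left₀ (norm_nonneg _) h2 2).trans_eq (Real.sq_sqrt ENNReal.toReal_nonneg)

/-- Dominated convergence for sums of squares, in `[0, ∞]`. -/
theorem tendsto_tsum_zero_of_dominated {α ι : Type*} {l : Filter α} {f : α → ι → ℝ≥0∞}
    {g : ι → ℝ≥0∞} (hg : ∑' i, g i ≠ ∞) (hf : ∀ᶠ a in l, ∀ i, f a i ≤ g i)
    (h : ∀ i, Tendsto (fun a => f a i) l (𝓝 0)) : Tendsto (fun a => ∑' i, f a i) l (𝓝 0) := by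
  have hgi := ENNReal.ne_top_of_tsum_ne_top hg
  have h1 : Tendsto (fun a => ∑' i, (f a i).toReal) l (𝓝 (∑' i : ι, (0 : ℝ))) := by
    refine tendsto_tsum_of_dominated_convergence (ENNReal.summable_toReal hg) (fun i => ?_) ?_
    · simpa [Function.comp_def] using (ENNReal.tendsto_toReal ENNReal.zero_ne_top).comp (h i)
    · filter_upwards [hf] with a ha i
      rw [Real.norm_of_nonneg ENNReal.toReal_nonneg]
      exact ENNReal.toReal_mono (hgi i) (ha i)
  have h2 := ENNReal.tendsto_ofReal h1
  simp only [tsum_zero, ENNReal.ofReal_zero] at h2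
  refine h2.congr' ?_
  filter_upwards [hf] with a ha
  have hfi (i : ι) : f a i ≠ ∞ := ne_top_of_le_ne_top (hgi i) (ha i)
  have hs : ∑' i, f a i ≠ ∞ := ne_top_of_le_ne_top hg (ENNReal.tsum_le_tsum ha)
  rw [← ENNReal.tsum_toReal_eq hfi, ENNReal.ofReal_toReal hs]

omit [InnerProductSpace ℂ 𝓗] [CompleteSpace 𝓗] in
theorem tendsto_enorm_sq_zero {α : Type*} {l : Filter α} {u : α → 𝓗} (h : Tendsto u l (𝓝 0)) :
    Tendsto (fun a => ‖u a‖ₑ ^ 2) l (𝓝 0) := by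
  have h1 : Continuous fun x : 𝓗 => ‖x‖ₑ ^ 2 :=
    (ENNReal.continuous_pow 2).comp continuous_enorm
  simpa [Function.comp_def] using (h1.tendsto 0).comp h

/-- A fixed Hilbert–Schmidt factor on the right upgrades strong convergence to Hilbert–Schmidt
convergence: the terms `‖D a (Y bᵢ)‖²` tend to zero and are dominated by `M² ‖Y bᵢ‖²`. -/
theorem tendsto_hsSq_comp_zero {α : Type*} {l : Filter α} {D : α → 𝓗 →L[ℂ] 𝓗} {M : ℝ}
    (hM : ∀ a, ‖D a‖ ≤ M) (hD : ∀ x, Tendsto (fun a => D a x) l (𝓝 0)) {Y : 𝓗 →L[ℂ] 𝓗}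
    (hY : hsSq Y ≠ ∞) : Tendsto (fun a => hsSq (D a ∘L Y)) l (𝓝 0) := by
  refine tendsto_tsum_zero_of_dominated
    (g := fun i => ENNReal.ofReal M ^ 2 * ‖Y (stdHilbertBasis 𝓗 i)‖ₑ ^ 2) ?_ ?_ ?_
  · rw [ENNReal.tsum_mul_left]
    exact ENNReal.mul_ne_top (by finiteness) hY
  · refine Eventually.of_forall fun a i => ?_
    rw [← mul_pow]
    gcongr
    refine ((D a).le_opENorm _).trans ?_
    refine mul_le_mul_left ?_ _
    rw [← ofReal_norm]
    exact ENNReal.ofReal_le_ofReal (hM a)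
  · exact fun i => tendsto_enorm_sq_zero (hD _)

/-- A Hilbert–Schmidt operator maps bounded weakly null sequences to norm null sequences. -/
theorem tendsto_zero_of_weakly_null {α : Type*} {l : Filter α} {Y : 𝓗 →L[ℂ] 𝓗} (hY : hsSq Y ≠ ∞)
    {u : α → 𝓗} {M : ℝ} (hM : ∀ a, ‖u a‖ ≤ M)
    (hu : ∀ h, Tendsto (fun a => inner ℂ h (u a)) l (𝓝 0)) :
    Tendsto (fun a => Y (u a)) l (𝓝 0) := by
  -- The coefficients of `Y (u a)` are `⟨Y† bᵢ, u a⟩`, so the dominating series is that of the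
  -- adjoint.
  rw [← hsSq_adjoint] at hY
  have h1 : Tendsto (fun a => ‖Y (u a)‖ₑ ^ 2) l (𝓝 0) := by
    simp_rw [← tsum_enorm_inner_sq (stdHilbertBasis 𝓗) (Y _)]
    refine tendsto_tsum_zero_of_dominated
      (g := fun i => ENNReal.ofReal M ^ 2 * ‖Y.adjoint (stdHilbertBasis 𝓗 i)‖ₑ ^ 2) ?_ ?_ ?_
    · rw [ENNReal.tsum_mul_left]
      exact ENNReal.mul_ne_top (by finiteness) hY
    · refine Eventually.of_forall fun a i => ?_
      rw [← mul_pow, ← ContinuousLinearMap.adjoint_inner_left]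
      gcongr
      rw [← ofReal_norm, ← ofReal_norm, ← ENNReal.ofReal_mul ((norm_nonneg _).trans (hM a))]
      refine ENNReal.ofReal_le_ofReal ((norm_inner_le_norm _ _).trans ?_)
      rw [mul_comm]
      gcongr
      exact hM a
    · intro i
      simp_rw [← ContinuousLinearMap.adjoint_inner_left]
      exact tendsto_enorm_sq_zero (hu _)
  rw [tendsto_zero_iff_norm_tendsto_zero]
  have h2 := (ENNReal.tendsto_toReal ENNReal.zero_ne_top).comp h1
  have h3 := (Real.continuous_sqrt.tendsto _).comp h2
  simpa [Function.comp_def] using h3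

/-- Projecting the range onto spans of finitely many basis vectors gives finite-rank operators that
converge to `Y` in Hilbert–Schmidt norm, hence in operator norm. -/
theorem isCompactOperator_of_hsSq {Y : 𝓗 →L[ℂ] 𝓗} (hY : hsSq Y ≠ ∞) : IsCompactOperator Y := by
  classical
  let U (s : Finset (basisIndex 𝓗)) : Submodule ℂ 𝓗 :=
    Submodule.span ℂ (s.image (stdHilbertBasis 𝓗) : Set 𝓗)
  have hU : Monotone U := fun s t h => Submodule.span_mono (by gcongr)
  have hfin (s) : FiniteDimensional ℂ (U s) :=
    FiniteDimensional.span_of_finite ℂ (Finset.finite_toSet _)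
  have hc (s) : IsCompactOperator ((U s).starProjection ∘L Y) := by
    have : ProperSpace (U s) := FiniteDimensional.proper ℂ (U s)
    exact (isCompactOperator_of_locallyCompactSpace_dom
      ((U s).orthogonalProjectionOnto ∘L Y)).clm_comp (U s).subtypeL
  refine isCompactOperator_of_tendsto (l := atTop) (F := fun s => (U s).starProjection ∘L Y) ?_
    (Eventually.of_forall hc)
  have h1 : Tendsto (fun s => hsSq (((U s).starProjection - 1) ∘L Y)) atTop (𝓝 0) := by
    refine tendsto_hsSq_comp_zero (M := 1 + 1) (fun s => ?_) (fun x => ?_) hY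
    · refine (norm_sub_le _ _).trans (add_le_add (U s).starProjection_norm_le ?_)
      exact ContinuousLinearMap.norm_id_le
    · have := Submodule.starProjection_tendsto_self U hU x
        (stdHilbertBasis 𝓗).finite_spans_dense.ge
      simpa using this.sub_const x
  have h2 : Tendsto (fun s => ‖((U s).starProjection - 1) ∘L Y‖ₑ ^ 2) atTop (𝓝 0) :=
    tendsto_of_tendsto_of_tendsto_of_le_of_le tendsto_const_nhds h1 (fun _ => bot_le)
      (fun s => enorm_sq_le_hsSq _)
  rw [tendsto_iff_norm_sub_tendsto_zero]
  have h3 := (Real.continuous_sqrt.tendsto _).comp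
    ((ENNReal.tendsto_toReal ENNReal.zero_ne_top).comp h2)
  have h4 (s) : (U s).starProjection ∘L Y - Y = ((U s).starProjection - 1) ∘L Y := by
    ext x; simp
  simpa [Function.comp_def, h4] using h3

/-- The orthogonal projection onto a finite-dimensional space is Hilbert–Schmidt. -/
theorem hsSq_starProjection_le (W : Submodule ℂ 𝓗) [FiniteDimensional ℂ W] :
    hsSq W.starProjection ≤ Module.finrank ℂ W := by
  let w := stdOrthonormalBasis ℂ W
  have h (x : 𝓗) : ‖W.starProjection x‖ₑ ^ 2 =
      ∑ j, ‖inner ℂ (w j : 𝓗) x‖ₑ ^ 2 := by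
    have := tsum_enorm_inner_sq w.toHilbertBasis (W.orthogonalProjectionOnto x)
    rw [tsum_fintype] at this
    rw [Submodule.starProjection_apply, ← ofReal_norm, Submodule.norm_coe, ofReal_norm, ← this]
    refine Finset.sum_congr rfl fun j _ => ?_
    rw [OrthonormalBasis.coe_toHilbertBasis, Submodule.inner_orthogonalProjectionOnto_eq_of_mem_left]
  rw [hsSq]
  simp_rw [h]
  rw [Summable.tsum_finsetSum fun _ _ => ENNReal.summable]
  have h1 (j) : ∑' i, ‖inner ℂ (w j : 𝓗) (stdHilbertBasis 𝓗 i)‖ₑ ^ 2 = 1 := by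
    simp_rw [enorm_inner_comm (w j : 𝓗)]
    rw [tsum_enorm_inner_sq, ← ofReal_norm, Submodule.norm_coe, w.norm_eq_one]
    simp
  simp [h1]

/-! ### Estimates of the trace norm -/

/-- The hypothesis says `K = Y† X`. The bound is Cauchy–Schwarz, once for vectors and once for sums.
-/
theorem traceNorm_le_of_inner_eq {K X Y : 𝓗 →L[ℂ] 𝓗}
    (h : ∀ e f, inner ℂ (K e) f = inner ℂ (X e) (Y f)) :
    traceNorm K ≤ (hsSq X) ^ (1 / 2 : ℝ) * (hsSq Y) ^ (1 / 2 : ℝ) := by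
  refine iSup_le fun n => iSup_le fun e => iSup_le fun f => iSup_le fun he => iSup_le fun hf => ?_
  calc ∑ i, ‖inner ℂ (K (e i)) (f i)‖ₑ
      ≤ ∑ i, ‖X (e i)‖ₑ * ‖Y (f i)‖ₑ := by
        refine Finset.sum_le_sum fun i _ => ?_
        rw [h, ← ofReal_norm, ← ofReal_norm, ← ofReal_norm, ← ENNReal.ofReal_mul (norm_nonneg _)]
        exact ENNReal.ofReal_le_ofReal (norm_inner_le_norm _ _)
    _ ≤ (∑ i, ‖X (e i)‖ₑ ^ (2 : ℝ)) ^ (1 / 2 : ℝ) * (∑ i, ‖Y (f i)‖ₑ ^ (2 : ℝ)) ^ (1 / 2 : ℝ) :=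
        ENNReal.inner_le_Lp_mul_Lq _ _ _ Real.HolderConjugate.two_two
    _ ≤ _ := by
        simp only [ENNReal.rpow_ofNat]
        gcongr
        · exact sum_enorm_sq_le_hsSq he X
        · exact sum_enorm_sq_le_hsSq hf Y

omit [CompleteSpace 𝓗] in
theorem traceNorm_add_le (K K' : 𝓗 →L[ℂ] 𝓗) : traceNorm (K + K') ≤ traceNorm K + traceNorm K' := by
  refine iSup_le fun n => iSup_le fun e => iSup_le fun f => iSup_le fun he => iSup_le fun hf => ?_
  have (S : 𝓗 →L[ℂ] 𝓗) : ∑ i, ‖inner ℂ (S (e i)) (f i)‖ₑ ≤ traceNorm S :=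
    le_iSup_of_le n <| le_iSup_of_le e <| le_iSup_of_le f <| le_iSup_of_le he <|
      le_iSup_of_le hf le_rfl
  refine le_trans ?_ (add_le_add (this K) (this K'))
  rw [← Finset.sum_add_distrib]
  refine Finset.sum_le_sum fun i _ => ?_
  rw [add_apply, inner_add_left]
  exact enorm_add_le _ _

/-- Here `K = X† X`; test the supremum defining the trace norm on pairs of equal families. -/
theorem hsSq_le_traceNorm {K X : 𝓗 →L[ℂ] 𝓗} (h : ∀ e, inner ℂ (K e) e = inner ℂ (X e) (X e)) :
    hsSq X ≤ traceNorm K := by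
  refine hsSq_le_of_forall_sum_le fun n e he => ?_
  refine le_iSup_of_le n <| le_iSup_of_le e <| le_iSup_of_le e <| le_iSup_of_le he <|
      le_iSup_of_le he ?_
  refine Finset.sum_le_sum fun i _ => ?_
  rw [h, inner_self_eq_norm_sq_to_K, norm_enorm_sq, ← ofReal_norm]
  simp

end HilbertSchmidt

/-! ### Orthogonal projections onto images and sums of subspaces -/

section Projections

variable {𝓗 : Type*} [NormedAddCommGroup 𝓗] [InnerProductSpace ℂ 𝓗] [CompleteSpace 𝓗]

theorem projOnto_eq_of_mem {S : Submodule ℂ 𝓗} {x u : 𝓗} (hu : u ∈ S)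
    (h : ∀ w ∈ S, inner ℂ (x - u) w = 0) : projOnto S x = u := by
  refine Submodule.eq_starProjection_of_mem_orthogonal (S.le_topologicalClosure hu) ?_
  rw [Submodule.orthogonal_closure]
  exact (Submodule.mem_orthogonal' _ _).2 h

theorem isClosed_of_projOnto_mem {S : Submodule ℂ 𝓗} (h : ∀ x, projOnto S x ∈ S) :
    IsClosed (S : Set 𝓗) := by
  refine isClosed_of_closure_subset fun x hx => ?_
  have : projOnto S x = x := Submodule.starProjection_eq_self_iff.2 hx
  exact this ▸ h x

theorem projOnto_mem {S : Submodule ℂ 𝓗} (hS : IsClosed (S : Set 𝓗)) (x : 𝓗) :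
    projOnto S x ∈ S := by
  have := Submodule.starProjection_apply_mem S.topologicalClosure x
  exact hS.submodule_topologicalClosure_eq.le this

theorem projOnto_of_mem {S : Submodule ℂ 𝓗} {x : 𝓗} (hx : x ∈ S) : projOnto S x = x :=
  Submodule.starProjection_eq_self_iff.2 (S.le_topologicalClosure hx)

theorem projOnto_projOnto (S : Submodule ℂ 𝓗) (x : 𝓗) :
    projOnto S (projOnto S x) = projOnto S x :=
  Submodule.starProjection_eq_self_iff.2 (Submodule.starProjection_apply_mem _ _)

theorem inner_projOnto_left (S : Submodule ℂ 𝓗) (x y : 𝓗) :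
    inner ℂ (projOnto S x) y = inner ℂ x (projOnto S y) :=
  Submodule.inner_starProjection_left_eq_right _ _ _

theorem inner_projOnto_projOnto (S : Submodule ℂ 𝓗) (x y : 𝓗) :
    inner ℂ (projOnto S x) (projOnto S y) = inner ℂ (projOnto S x) y := by
  rw [← inner_projOnto_left, projOnto_projOnto]

theorem inner_sub_projOnto {S : Submodule ℂ 𝓗} (x : 𝓗) {w : 𝓗} (hw : w ∈ S) :
    inner ℂ (x - projOnto S x) w = 0 := by
  rw [inner_sub_left, inner_projOnto_left, projOnto_of_mem hw, sub_self]

theorem norm_projOnto_apply_le (S : Submodule ℂ 𝓗) (x : 𝓗) : ‖projOnto S x‖ ≤ ‖x‖ :=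
  Submodule.norm_starProjection_apply_le _ _

theorem inner_left_eq_right {m : 𝓗 →L[ℂ] 𝓗} (hm : IsSelfAdjoint m) (x y : 𝓗) :
    inner ℂ (m x) y = inner ℂ x (m y) := by
  rw [← ContinuousLinearMap.adjoint_inner_left, hm.adjoint_eq]

/-- If `m` is bounded below on a closed subspace `L` with projection `Q`, the projection onto
`m L` is `m Q T Q m`, where `T` is inverse to `1 - Q (1 - m²) Q`. -/
theorem exists_projOnto_map_eq {L : Submodule ℂ 𝓗} (hL : IsClosed (L : Set 𝓗)) {m : 𝓗 →L[ℂ] 𝓗}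
    (hm : IsSelfAdjoint m) {κ : ℝ} (hκ0 : 0 < κ) (hκ1 : κ ≤ 1)
    (hκ : ∀ f ∈ L, κ * ‖f‖ ≤ ‖m f‖) :
    ∃ T : 𝓗 →L[ℂ] 𝓗, IsSelfAdjoint T ∧ ‖T‖ ≤ (κ ^ 2)⁻¹ ∧
      (∀ x, T (x - projOnto L x + projOnto L (m (m (projOnto L x)))) = x) ∧
      (∀ x, T (projOnto L x) = projOnto L (T x)) ∧
      (∀ x, projOnto (L.map (m : 𝓗 →ₗ[ℂ] 𝓗)) x = m (projOnto L (T (projOnto L (m x))))) := by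
  set Q := projOnto L with hQ
  let A : 𝓗 →L[ℂ] 𝓗 := 1 - Q + Q * (m * (m * Q))
  -- Coercivity: `⟨A x, x⟩ = ‖x‖² - ‖Q x‖² + ‖m Q x‖² ≥ ‖x‖² - (1 - κ²) ‖Q x‖² ≥ κ² ‖x‖²`. This
  -- makes `A` invertible and bounds its inverse by `κ⁻²`.
  have hA (x : 𝓗) : A x = x - Q x + Q (m (m (Q x))) := by simp [A]
  have hcoer (x : 𝓗) : ‖x‖ ^ 2 * κ ^ 2 ≤ ‖inner ℂ (A x) x‖ := by
    have h1 : inner ℂ (A x) x = ((‖x‖ ^ 2 - ‖Q x‖ ^ 2 + ‖m (Q x)‖ ^ 2 : ℝ) : ℂ) := by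
      rw [hA, inner_add_left, inner_sub_left, hQ, inner_projOnto_left _ (m _), ← hQ,
        inner_left_eq_right hm, ← inner_projOnto_projOnto]
      simp only [inner_self_eq_norm_sq_to_K]
      push_cast
      rfl
    have h2 : ‖Q x‖ ≤ ‖x‖ := norm_projOnto_apply_le _ _
    have h3 := hκ _ (projOnto_mem hL x)
    have h4 : κ ^ 2 * ‖Q x‖ ^ 2 ≤ ‖m (Q x)‖ ^ 2 := by
      rw [← mul_pow]; gcongr
    have h5 : ‖Q x‖ ^ 2 ≤ ‖x‖ ^ 2 := by gcongr
    have h6 : κ ^ 2 ≤ 1 := pow_le_one₀ hκ0.le hκ1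
    rw [h1, Complex.norm_real]
    refine le_trans ?_ (le_abs_self _)
    nlinarith [mul_nonneg (sub_nonneg.2 h5) (sub_nonneg.2 h6)]
  have hunit : IsUnit A := by
    refine ContinuousLinearMap.isUnit_of_forall_le_norm_inner_map A
      (c := ⟨κ ^ 2, by positivity⟩) ?_ hcoer
    exact_mod_cast pow_pos hκ0 2
  obtain ⟨u, hu⟩ := hunit
  obtain ⟨T, hTA, hAT⟩ : ∃ T : 𝓗 →L[ℂ] 𝓗, T * A = 1 ∧ A * T = 1 :=
    ⟨↑u⁻¹, by rw [← hu]; simp, by rw [← hu]; simp⟩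
  have hTA' (x) : T (A x) = x := by simpa using congr($hTA x)
  have hAT' (x) : A (T x) = x := by simpa using congr($hAT x)
  have hAsa (x y) : inner ℂ (A x) y = inner ℂ x (A y) := by
    simp only [hA, inner_add_left, inner_add_right, inner_sub_left, inner_sub_right, hQ,
      inner_projOnto_left, inner_left_eq_right hm]
  have hAQ (x) : A (Q x) = Q (A x) := by
    simp only [hA, hQ, map_add, map_sub, projOnto_projOnto]
  have hTQ (x) : T (Q x) = Q (T x) := by
    conv_lhs => rw [← hAT' x, ← hAQ, hTA']
  refine ⟨T, ?_, ?_, fun x => by rw [← hA, hTA'], hTQ, fun x => ?_⟩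
  · rw [ContinuousLinearMap.isSelfAdjoint_iff_isSymmetric]
    intro x y
    change inner ℂ (T x) y = inner ℂ x (T y)
    conv_lhs => rw [← hAT' y, ← hAsa, hAT']
  · refine T.opNorm_le_bound (by positivity) fun x => ?_
    have h1 := hcoer (T x)
    rw [hAT'] at h1
    have h2 := h1.trans (norm_inner_le_norm _ _)
    rcases (norm_nonneg (T x)).eq_or_lt with h | h
    · rw [← h]; positivity
    · rw [← div_eq_inv_mul, le_div_iff₀ (by positivity)]
      refine le_of_mul_le_mul_right ?_ h
      linarith
  · refine projOnto_eq_of_mem (Submodule.mem_map_of_mem (projOnto_mem hL _)) ?_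
    rintro _ ⟨f, hf, rfl⟩
    change inner ℂ _ (m f) = 0
    rw [← inner_left_eq_right hm, ← projOnto_of_mem hf, ← inner_projOnto_left, map_sub, map_sub,
      ← hQ]
    -- On the range of `Q`, which `T` preserves, `A` reduces to `Q m² Q`; so `Q m² Q T Q m x = Q m
    -- x`, which is the required orthogonality to `m L`.
    have h1 := hAT' (Q (m x))
    rw [hA, ← hTQ, hTQ, hQ, projOnto_projOnto, ← hQ, ← hTQ, sub_self, zero_add] at h1
    rw [← hTQ, hQ, projOnto_projOnto, ← hQ, h1, sub_self, inner_zero_left]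

theorem isClosed_map_of_bounded_below {L : Submodule ℂ 𝓗} (hL : IsClosed (L : Set 𝓗))
    {m : 𝓗 →L[ℂ] 𝓗} (hm : IsSelfAdjoint m) {κ : ℝ} (hκ0 : 0 < κ) (hκ1 : κ ≤ 1)
    (hκ : ∀ f ∈ L, κ * ‖f‖ ≤ ‖m f‖) : IsClosed (L.map (m : 𝓗 →ₗ[ℂ] 𝓗) : Set 𝓗) := by
  obtain ⟨T, -, -, -, -, h⟩ := exists_projOnto_map_eq hL hm hκ0 hκ1 hκ
  refine isClosed_of_projOnto_mem fun x => ?_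
  rw [h]
  exact Submodule.mem_map_of_mem (projOnto_mem hL _)

/-- The component of `V` orthogonal to `L`. -/
noncomputable def orthoPart (L V : Submodule ℂ 𝓗) : Submodule ℂ 𝓗 :=
  V.map ((1 - projOnto L : 𝓗 →L[ℂ] 𝓗) : 𝓗 →ₗ[ℂ] 𝓗)

theorem mem_orthoPart {L V : Submodule ℂ 𝓗} {w : 𝓗} :
    w ∈ orthoPart L V ↔ ∃ v ∈ V, v - projOnto L v = w := Iff.rfl

theorem isClosed_orthoPart (L V : Submodule ℂ 𝓗) [FiniteDimensional ℂ V] :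
    IsClosed (orthoPart L V : Set 𝓗) := by
  have : FiniteDimensional ℂ (orthoPart L V) := by unfold orthoPart; infer_instance
  exact Submodule.closed_of_finiteDimensional _

/-- `L + V` is the orthogonal sum of `L` and `orthoPart L V`. -/
theorem projOnto_sup {L V : Submodule ℂ 𝓗} (hL : IsClosed (L : Set 𝓗)) [FiniteDimensional ℂ V] :
    projOnto (L ⊔ V) = projOnto L + projOnto (orthoPart L V) := by
  have hort (w) (hw : w ∈ orthoPart L V) (l) (hl : l ∈ L) : inner ℂ w l = 0 := by
    obtain ⟨v, -, rfl⟩ := mem_orthoPart.1 hw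
    exact inner_sub_projOnto v hl
  ext x
  obtain ⟨v₀, hv₀, h₀⟩ := mem_orthoPart.1 (projOnto_mem (isClosed_orthoPart L V) x)
  refine projOnto_eq_of_mem ?_ ?_
  · rw [add_apply, ← h₀]
    exact add_mem (Submodule.mem_sup_left (projOnto_mem hL x)) (sub_mem (Submodule.mem_sup_right hv₀)
      (Submodule.mem_sup_left (projOnto_mem hL v₀)))
  · intro w hw
    obtain ⟨l, hl, v, hv, rfl⟩ := Submodule.mem_sup.1 hw
    have hl' : l + projOnto L v ∈ L := add_mem hl (projOnto_mem hL v)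
    have hv' : v - projOnto L v ∈ orthoPart L V := mem_orthoPart.2 ⟨v, hv, rfl⟩
    -- Split the test vector along the orthogonal sum, and group the residual in two ways, so that
    -- each component meets the projection error of its own summand.
    have e1 : l + v = (l + projOnto L v) + (v - projOnto L v) := by abel
    have e2 : x - (projOnto L + projOnto (orthoPart L V)) x =
      (x - projOnto L x) - projOnto (orthoPart L V) x := by rw [add_apply]; abel
    have e3 : x - (projOnto L + projOnto (orthoPart L V)) x =
      (x - projOnto (orthoPart L V) x) - projOnto L x := by rw [add_apply]; abel
    rw [e1, inner_add_right]
    rw [show inner ℂ (x - (projOnto L + projOnto (orthoPart L V)) x) (l + projOnto L v) = 0 by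
      rw [e2, inner_sub_left, inner_sub_projOnto x hl',
        hort _ (projOnto_mem (isClosed_orthoPart L V) x) _ hl', sub_zero]]
    rw [e3, inner_sub_left, inner_sub_projOnto x hv', ← inner_conj_symm,
      hort _ hv' _ (projOnto_mem hL x)]
    simp

theorem hsSq_projOnto_orthoPart_le (L V : Submodule ℂ 𝓗) [FiniteDimensional ℂ V] :
    hsSq (projOnto (orthoPart L V)) ≤ Module.finrank ℂ V := by
  have hfin : FiniteDimensional ℂ (orthoPart L V) := by unfold orthoPart; infer_instance
  have h : projOnto (orthoPart L V) = (orthoPart L V).starProjection := by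
    ext x
    refine projOnto_eq_of_mem (Submodule.starProjection_apply_mem _ _) fun w hw => ?_
    exact Submodule.starProjection_inner_eq_zero _ _ hw
  rw [h]
  refine (hsSq_starProjection_le _).trans ?_
  exact_mod_cast Submodule.finrank_map_le _ V

end Projections

/-! ### Trace norms of compressed projections -/

section Compressions

variable {𝓗 : Type*} [NormedAddCommGroup 𝓗] [InnerProductSpace ℂ 𝓗] [CompleteSpace 𝓗]

theorem hsSq_comp_eq_of_selfAdjoint {X Y : 𝓗 →L[ℂ] 𝓗} (hX : IsSelfAdjoint X)
    (hY : IsSelfAdjoint Y) : hsSq (X ∘L Y) = hsSq (Y ∘L X) := by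
  rw [← hsSq_adjoint, ContinuousLinearMap.adjoint_comp, hX.adjoint_eq, hY.adjoint_eq]

theorem isSelfAdjoint_projOnto (S : Submodule ℂ 𝓗) : IsSelfAdjoint (projOnto S) :=
  isSelfAdjoint_starProjection _

/-- With `P` the projection, `χ P χ = (P χ)† (P χ)`. -/
theorem traceNorm_compress_projOnto_le (S : Submodule ℂ 𝓗) {χ : 𝓗 →L[ℂ] 𝓗}
    (hχ : IsSelfAdjoint χ) :
    traceNorm (χ ∘L projOnto S ∘L χ) ≤ hsSq (projOnto S ∘L χ) := by
  have h (e f : 𝓗) : inner ℂ ((χ ∘L projOnto S ∘L χ) e) f =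
      inner ℂ ((projOnto S ∘L χ) e) ((projOnto S ∘L χ) f) := by
    simp only [ContinuousLinearMap.comp_apply, inner_projOnto_projOnto,
      inner_left_eq_right hχ]
  refine (traceNorm_le_of_inner_eq h).trans_eq ?_
  rw [← ENNReal.rpow_add_of_nonneg _ _ (by norm_num) (by norm_num)]
  norm_num

theorem hsSq_le_traceNorm_compress_projOnto (S : Submodule ℂ 𝓗) {χ : 𝓗 →L[ℂ] 𝓗}
    (hχ : IsSelfAdjoint χ) :
    hsSq (projOnto S ∘L χ) ≤ traceNorm (χ ∘L projOnto S ∘L χ) := by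
  refine hsSq_le_traceNorm fun e => ?_
  simp only [ContinuousLinearMap.comp_apply, inner_projOnto_projOnto,
      inner_left_eq_right hχ]

/-- Write `χ P = (χ P) P`: the first factor is measured in operator norm, and the second has squared
Hilbert–Schmidt norm at most `dim V`. -/
theorem hsSq_projOnto_orthoPart_comp_le (L V : Submodule ℂ 𝓗) [FiniteDimensional ℂ V]
    {χ : 𝓗 →L[ℂ] 𝓗} (hχ : IsSelfAdjoint χ) :
    hsSq (projOnto (orthoPart L V) ∘L χ) ≤
      ‖χ ∘L projOnto (orthoPart L V)‖ₑ ^ 2 * Module.finrank ℂ V := by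
  rw [hsSq_comp_eq_of_selfAdjoint (isSelfAdjoint_projOnto _) hχ]
  have : χ ∘L projOnto (orthoPart L V) =
      (χ ∘L projOnto (orthoPart L V)) ∘L projOnto (orthoPart L V) := by
    ext x; simp [projOnto_projOnto]
  conv_lhs => rw [this]
  refine (hsSq_comp_le_left _ _).trans ?_
  gcongr
  exact hsSq_projOnto_orthoPart_le L V

theorem traceNorm_compress_projOnto_sup_lt_top {L V : Submodule ℂ 𝓗} (hL : IsClosed (L : Set 𝓗))
    [FiniteDimensional ℂ V] {m : 𝓗 →L[ℂ] 𝓗} (hm : IsSelfAdjoint m) {κ : ℝ} (hκ0 : 0 < κ)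
    (hκ1 : κ ≤ 1) (hκ : ∀ f ∈ L, κ * ‖f‖ ≤ ‖m f‖) {χ : 𝓗 →L[ℂ] 𝓗} (hχ : IsSelfAdjoint χ)
    (hcomm : ∀ x, χ (m x) = m (χ x)) (hL1 : hsSq (projOnto L ∘L χ) ≠ ∞) :
    traceNorm (χ ∘L projOnto (L.map (m : 𝓗 →ₗ[ℂ] 𝓗) ⊔ V) ∘L χ) < ∞ := by
  obtain ⟨T, -, -, -, -, hT⟩ := exists_projOnto_map_eq hL hm hκ0 hκ1 hκ
  rw [projOnto_sup (isClosed_map_of_bounded_below hL hm hκ0 hκ1 hκ),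
    ContinuousLinearMap.add_comp, ContinuousLinearMap.comp_add]
  refine (traceNorm_add_le _ _).trans_lt (ENNReal.add_lt_top.2 ⟨?_, ?_⟩)
  · refine (traceNorm_compress_projOnto_le _ hχ).trans_lt ?_
    -- Since `m` commutes with `χ`, the factor `Q χ` can be isolated between bounded operators.
    have : projOnto (L.map (m : 𝓗 →ₗ[ℂ] 𝓗)) ∘L χ =
        (m ∘L projOnto L ∘L T) ∘L (projOnto L ∘L χ) ∘L m := by
      ext x; simp [hT, hcomm]
    rw [this]
    refine (hsSq_comp_le_left _ _).trans_lt (ENNReal.mul_lt_top (by finiteness) ?_)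
    exact (hsSq_comp_le_right _ _).trans_lt (ENNReal.mul_lt_top (by finiteness) hL1.lt_top)
  · refine (traceNorm_compress_projOnto_le _ hχ).trans_lt ?_
    refine (hsSq_projOnto_orthoPart_comp_le _ _ hχ).trans_lt ?_
    exact ENNReal.mul_lt_top (by finiteness) (by finiteness)

theorem tendsto_mul_sqrt_zero {α : Type*} {l : Filter α} {f g : α → ℝ≥0∞} {C : ℝ≥0∞} (hC : C ≠ ∞)
    (hf : Tendsto f l (𝓝 0)) (hg : ∀ a, g a ≤ C) :
    Tendsto (fun a => f a ^ (1 / 2 : ℝ) * g a ^ (1 / 2 : ℝ)) l (𝓝 0) := by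
  have h1 : Tendsto (fun a => f a ^ (1 / 2 : ℝ) * C ^ (1 / 2 : ℝ)) l (𝓝 0) := by
    have := ENNReal.Tendsto.mul_const (b := C ^ (1 / 2 : ℝ))
      ((ENNReal.continuous_rpow_const (y := (1 / 2 : ℝ))).tendsto 0 |>.comp hf)
      (Or.inr (by finiteness))
    simpa [Function.comp_def] using this
  refine tendsto_of_tendsto_of_tendsto_of_le_of_le tendsto_const_nhds h1 (fun _ => bot_le) ?_
  intro a
  dsimp only
  gcongr
  exact hg a

end Compressions

/-! ### Convergence of the projections, abstractly -/

section Convergence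

variable {𝓗 : Type*} [NormedAddCommGroup 𝓗] [InnerProductSpace ℂ 𝓗] [CompleteSpace 𝓗]

omit [CompleteSpace 𝓗] in
theorem tendsto_apply_of_bounded {A : ℕ → 𝓗 →L[ℂ] 𝓗} {M : ℝ} (hM : ∀ n, ‖A n‖ ≤ M)
    {u : ℕ → 𝓗} (hu : Tendsto u atTop (𝓝 0)) : Tendsto (fun n => A n (u n)) atTop (𝓝 0) := by
  rw [tendsto_zero_iff_norm_tendsto_zero] at hu ⊢
  refine squeeze_zero (fun _ => norm_nonneg _) (fun n => ((A n).le_opNorm _).trans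
    (mul_le_mul_of_nonneg_right (hM n) (norm_nonneg _))) ?_
  simpa using hu.const_mul M

omit [CompleteSpace 𝓗] in
theorem tendsto_apply_of_strong {A : ℕ → 𝓗 →L[ℂ] 𝓗} {A₀ : 𝓗 →L[ℂ] 𝓗} {M : ℝ}
    (hM : ∀ n, ‖A n‖ ≤ M) (hA : ∀ x, Tendsto (fun n => A n x) atTop (𝓝 (A₀ x)))
    {u : ℕ → 𝓗} {x : 𝓗} (hu : Tendsto u atTop (𝓝 x)) :
    Tendsto (fun n => A n (u n)) atTop (𝓝 (A₀ x)) := by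
  have h1 := tendsto_apply_of_bounded hM (tendsto_sub_nhds_zero_iff.2 hu)
  simpa using h1.add (hA x)

variable {L : Submodule ℂ 𝓗} (hL : IsClosed (L : Set 𝓗)) {m : ℕ → 𝓗 →L[ℂ] 𝓗}
  (hm : ∀ n, IsSelfAdjoint (m n)) (hm1 : ∀ n, ‖m n‖ ≤ 1)
  (hmt : ∀ x, Tendsto (fun n => m n x) atTop (𝓝 x)) {κ : ℝ} (hκ0 : 0 < κ) (hκ1 : κ ≤ 1)
  (hκ : ∀ n, ∀ f ∈ L, κ * ‖f‖ ≤ ‖m n f‖) {χ : 𝓗 →L[ℂ] 𝓗} (hχ : IsSelfAdjoint χ)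
  (hcomm : ∀ n x, χ (m n x) = m n (χ x)) (hL1 : hsSq (projOnto L ∘L χ) ≠ ∞)

include hm1 hmt in
-- With `A n = 1 - Q + Q (m n)² Q`, one has `T n x - x = T n (x - A n x)`, where `A n x → x` and `T
-- n` is bounded uniformly.
theorem tendsto_inverse {T : ℕ → 𝓗 →L[ℂ] 𝓗} {M : ℝ} (hTM : ∀ n, ‖T n‖ ≤ M)
    (hT : ∀ n x, T n (x - projOnto L x + projOnto L (m n (m n (projOnto L x)))) = x) (x : 𝓗) :
    Tendsto (fun n => T n x) atTop (𝓝 x) := by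
  have h1 : Tendsto (fun n => x - (x - projOnto L x + projOnto L (m n (m n (projOnto L x)))))
      atTop (𝓝 0) := by
    have h2 : Tendsto (fun n => m n (m n (projOnto L x))) atTop (𝓝 (projOnto L x)) :=
      tendsto_apply_of_strong (A₀ := 1) hm1 hmt (hmt _)
    have h3 := ((projOnto L).continuous.tendsto _).comp h2
    rw [projOnto_projOnto] at h3
    simpa using (h3.const_add (x - projOnto L x)).const_sub x
  have h2 := tendsto_apply_of_bounded hTM h1
  simp only [map_sub, hT] at h2
  simpa using h2.add_const x

include hL hm hm1 hmt hκ0 hκ1 hκ hχ hcomm hL1 in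
theorem tendsto_traceNorm_projOnto_map :
    Tendsto (fun n => traceNorm
      (χ ∘L (projOnto (L.map (m n : 𝓗 →ₗ[ℂ] 𝓗)) - projOnto L) ∘L χ)) atTop (𝓝 0) := by
  choose T hTsa hTn hTA hTQ hT using fun n => exists_projOnto_map_eq hL (hm n) hκ0 hκ1 (hκ n)
  have hTt := tendsto_inverse hm1 hmt hTn hTA
  set Q := projOnto L with hQ
  let Y : 𝓗 →L[ℂ] 𝓗 := Q ∘L χ
  -- Telescope `χ m Q T Q m χ - χ Q χ`, replacing `T`, the right `m` and the left `m` by 1 in turn.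
  -- Each term is a product of two Hilbert–Schmidt operators, one of which tends to zero.
  let K1 (n) : 𝓗 →L[ℂ] 𝓗 := χ ∘L m n ∘L Q ∘L (T n - 1) ∘L Y ∘L m n
  let K2 (n) : 𝓗 →L[ℂ] 𝓗 := χ ∘L m n ∘L Q ∘L Y ∘L (m n - 1)
  let K3 (n) : 𝓗 →L[ℂ] 𝓗 := χ ∘L (m n - 1) ∘L Q ∘L Y
  have hm1sa (n) : IsSelfAdjoint (m n - 1) := (hm n).sub (.one _)
  have hK (n) : χ ∘L (projOnto (L.map (m n : 𝓗 →ₗ[ℂ] 𝓗)) - Q) ∘L χ = K1 n + K2 n + K3 n := by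
    ext x
    simp only [ContinuousLinearMap.comp_apply, sub_apply, add_apply, hT, K1, K2, K3, Y, map_sub,
      one_apply_eq_self, hcomm, hQ, projOnto_projOnto]
    abel
  have e1 (n) (e f : 𝓗) : inner ℂ (K1 n e) f =
      inner ℂ (((T n - 1) ∘L Y ∘L m n) e) ((Y ∘L m n) f) := by
    simp only [K1, Y, ContinuousLinearMap.comp_apply, inner_left_eq_right hχ,
      inner_left_eq_right (hm n), hQ, inner_projOnto_left, hcomm]
  have e2 (n) (e f : 𝓗) : inner ℂ (K2 n e) f =
      inner ℂ ((Y ∘L (m n - 1)) e) ((Y ∘L m n) f) := by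
    simp only [K2, Y, ContinuousLinearMap.comp_apply, inner_left_eq_right hχ,
      inner_left_eq_right (hm n), hQ, inner_projOnto_left, hcomm]
  have e3 (n) (e f : 𝓗) : inner ℂ (K3 n e) f =
      inner ℂ (Y e) ((Y ∘L (m n - 1)) f) := by
    simp only [K3, ContinuousLinearMap.comp_apply]
    rw [inner_left_eq_right hχ, inner_left_eq_right (hm1sa n), hQ, inner_projOnto_left]
    simp only [Y, ContinuousLinearMap.comp_apply, sub_apply, hcomm, map_sub, one_apply_eq_self, hQ]
  have hm_right (n) (Z : 𝓗 →L[ℂ] 𝓗) : hsSq (Z ∘L m n) ≤ hsSq Z := by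
    refine (hsSq_comp_le_right _ _).trans ?_
    refine mul_le_of_le_one_left bot_le (pow_le_one₀ bot_le ?_)
    rw [← ofReal_norm]
    exact ENNReal.ofReal_le_one.2 (hm1 n)
  have hYm : Tendsto (fun n => hsSq (Y ∘L (m n - 1))) atTop (𝓝 0) := by
    -- Strong convergence helps only on the left of a Hilbert–Schmidt operator, hence the adjoint.
    have h1 : Tendsto (fun n => hsSq ((m n - 1) ∘L Y.adjoint)) atTop (𝓝 0) := by
      refine tendsto_hsSq_comp_zero (M := 1 + 1) (fun n => ?_) (fun x => ?_)
        ((hsSq_adjoint Y).trans_ne hL1)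
      · exact (norm_sub_le _ _).trans (add_le_add (hm1 n) ContinuousLinearMap.norm_id_le)
      · simpa using (hmt x).sub_const x
    refine h1.congr fun n => ?_
    rw [← hsSq_adjoint, ContinuousLinearMap.adjoint_comp, ContinuousLinearMap.adjoint_adjoint,
      (hm1sa n).adjoint_eq]
  have hTY : Tendsto (fun n => hsSq ((T n - 1) ∘L Y ∘L m n)) atTop (𝓝 0) := by
    have h1 : Tendsto (fun n => hsSq ((T n - 1) ∘L Y)) atTop (𝓝 0) := by
      refine tendsto_hsSq_comp_zero (M := (κ ^ 2)⁻¹ + 1) (fun n => ?_) (fun x => ?_) hL1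
      · exact (norm_sub_le _ _).trans (add_le_add (hTn n) ContinuousLinearMap.norm_id_le)
      · simpa using (hTt x).sub_const x
    refine tendsto_of_tendsto_of_tendsto_of_le_of_le tendsto_const_nhds h1 (fun _ => bot_le)
      fun n => ?_
    dsimp only
    rw [← ContinuousLinearMap.comp_assoc]
    exact hm_right n _
  have t1 := tendsto_mul_sqrt_zero hL1 hTY (fun n => hm_right n Y)
  have t2 := tendsto_mul_sqrt_zero hL1 hYm (fun n => hm_right n Y)
  have t3 := tendsto_mul_sqrt_zero hL1 hYm (fun _ => le_refl (hsSq Y))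
  have t := (t1.add t2).add t3
  rw [add_zero, add_zero] at t
  refine tendsto_of_tendsto_of_tendsto_of_le_of_le tendsto_const_nhds t (fun _ => bot_le)
    fun n => ?_
  dsimp only
  rw [hK]
  refine (traceNorm_add_le _ _).trans
    (add_le_add ((traceNorm_add_le _ _).trans (add_le_add ?_ ?_)) ?_)
  · exact traceNorm_le_of_inner_eq (e1 n)
  · exact traceNorm_le_of_inner_eq (e2 n)
  · rw [mul_comm]
    exact traceNorm_le_of_inner_eq (e3 n)

omit [CompleteSpace 𝓗] in
theorem exists_norm_le_two_mul (A : 𝓗 →L[ℂ] 𝓗) : ∃ x, ‖x‖ ≤ 1 ∧ ‖A‖ ≤ 2 * ‖A x‖ := by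
  rcases (norm_nonneg A).eq_or_lt with h | h
  · exact ⟨0, by simp, by simp [← h]⟩
  · obtain ⟨x, hx, hAx⟩ := A.exists_lt_apply_of_lt_opNorm (half_lt_self h)
    exact ⟨x, hx.le, by linarith⟩

variable {V : ℕ → Submodule ℂ 𝓗} [∀ n, FiniteDimensional ℂ (V n)] {C : ℝ} (hC0 : 0 ≤ C)
  (hC : ∀ n, ∀ v ∈ V n, ‖v‖ ≤ C * ‖v - projOnto (L.map (m n : 𝓗 →ₗ[ℂ] 𝓗)) v‖)
  (hweak : ∀ v : ℕ → 𝓗, (∀ n, v n ∈ V n) → (∀ n, ‖v n‖ ≤ C) →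
    ∀ h, Tendsto (fun n => inner ℂ h (v n)) atTop (𝓝 0))
  (hloc : ∀ v : ℕ → 𝓗, (∀ n, v n ∈ V n) → (∀ n, ‖v n‖ ≤ C) →
    Tendsto (fun n => χ (v n)) atTop (𝓝 0))

include hL hm hm1 hmt hκ0 hκ1 hκ hχ hcomm hL1 hC0 hC hweak hloc in
-- Test on nearly maximizing vectors `x n` of the unit ball. The projection of `x n` is `v n - P v
-- n` with `P` the projection onto `m n L`, and `hC` keeps `v n` bounded. Then `χ v n → 0` by
-- `hloc`, while `χ P v n = m n (χ Q f n)` with `f n` bounded and weakly null, so `χ Q f n → 0`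
-- because `χ Q` is Hilbert–Schmidt.
theorem tendsto_norm_comp_projOnto_orthoPart :
    Tendsto (fun n => ‖χ ∘L projOnto (orthoPart (L.map (m n : 𝓗 →ₗ[ℂ] 𝓗)) (V n))‖)
      atTop (𝓝 0) := by
  choose T hTsa hTn hTA hTQ hT using fun n => exists_projOnto_map_eq hL (hm n) hκ0 hκ1 (hκ n)
  have hTt := tendsto_inverse hm1 hmt hTn hTA
  choose x hx1 hx using fun n => exists_norm_le_two_mul
    (χ ∘L projOnto (orthoPart (L.map (m n : 𝓗 →ₗ[ℂ] 𝓗)) (V n)))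
  choose v hv hvx using fun n => mem_orthoPart.1 (projOnto_mem
    (isClosed_orthoPart (L.map (m n : 𝓗 →ₗ[ℂ] 𝓗)) (V n)) (x n))
  have hvC (n) : ‖v n‖ ≤ C := by
    refine (hC n _ (hv n)).trans (mul_le_of_le_one_right hC0 ?_)
    rw [hvx]
    exact (norm_projOnto_apply_le _ _).trans (hx1 n)
  let f (n) : 𝓗 := projOnto L (T n (projOnto L (m n (v n))))
  have hf (n) : ‖f n‖ ≤ (κ ^ 2)⁻¹ * C := by
    refine (norm_projOnto_apply_le _ _).trans ((T n).le_of_opNorm_le_of_le (hTn n) ?_)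
    refine (norm_projOnto_apply_le _ _).trans (((m n).le_of_opNorm_le_of_le (hm1 n) (hvC n)).trans ?_)
    rw [one_mul]
  have hfw (h : 𝓗) : Tendsto (fun n => inner ℂ h (f n)) atTop (𝓝 0) := by
    -- Move the operators onto `h`: there they converge in norm to `Q h`, and a norm-convergent
    -- sequence paired with a bounded weakly null one tends to zero.
    have h1 : Tendsto (fun n => m n (projOnto L (T n (projOnto L h)))) atTop
        (𝓝 (projOnto L h)) := by
      refine tendsto_apply_of_strong (A₀ := 1) hm1 hmt ?_
      have := ((projOnto L).continuous.tendsto _).comp (hTt (projOnto L h))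
      rwa [projOnto_projOnto] at this
    have h2 : Tendsto (fun n => inner ℂ (m n (projOnto L (T n (projOnto L h))) - projOnto L h)
        (v n)) atTop (𝓝 0) := by
      rw [tendsto_zero_iff_norm_tendsto_zero]
      refine squeeze_zero (fun _ => norm_nonneg _) (fun n => (norm_inner_le_norm _ _).trans
        (mul_le_mul_of_nonneg_left (hvC n) (norm_nonneg _))) ?_
      simpa using (tendsto_iff_norm_sub_tendsto_zero.1 h1).mul_const C
    have h3 := h2.add (hweak v hv hvC (projOnto L h))
    rw [add_zero] at h3
    refine h3.congr fun n => ?_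
    rw [← inner_add_left, sub_add_cancel, inner_left_eq_right (hm n), inner_projOnto_left,
      inner_left_eq_right (hTsa n), inner_projOnto_left]
  have hχf : Tendsto (fun n => (χ ∘L projOnto L) (f n)) atTop (𝓝 0) := by
    refine tendsto_zero_of_weakly_null ?_ hf hfw
    rwa [hsSq_comp_eq_of_selfAdjoint hχ (isSelfAdjoint_projOnto L)]
  have h1 := tendsto_apply_of_bounded hm1 hχf
  have h2 := (hloc v hv hvC).sub h1
  rw [sub_zero, tendsto_zero_iff_norm_tendsto_zero] at h2
  refine squeeze_zero (fun _ => norm_nonneg _) (fun n => hx n) ?_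
  have h3 := h2.const_mul 2
  rw [mul_zero] at h3
  refine h3.congr fun n => ?_
  simp only [f, ContinuousLinearMap.comp_apply, projOnto_projOnto]
  rw [← hvx, hT, map_sub, hcomm]

variable {d : ℕ} (hd : ∀ n, Module.finrank ℂ (V n) ≤ d)

include hL hm hm1 hmt hκ0 hκ1 hκ hχ hcomm hL1 hC0 hC hweak hloc hd in
theorem tendsto_traceNorm_projOnto_sup :
    Tendsto (fun n => traceNorm
      (χ ∘L (projOnto (L.map (m n : 𝓗 →ₗ[ℂ] 𝓗) ⊔ V n) - projOnto L) ∘L χ)) atTop (𝓝 0) := by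
  have h1 := tendsto_traceNorm_projOnto_map hL hm hm1 hmt hκ0 hκ1 hκ hχ hcomm hL1
  have h2 := tendsto_norm_comp_projOnto_orthoPart hL hm hm1 hmt hκ0 hκ1 hκ hχ hcomm hL1
    hC0 hC hweak hloc
  have h3 := ENNReal.Tendsto.mul_const (b := (d : ℝ≥0∞))
    (tendsto_enorm_sq_zero (tendsto_zero_iff_norm_tendsto_zero.2 h2)) (Or.inr (by finiteness))
  have h4 := h1.add h3
  rw [zero_mul, add_zero] at h4
  refine tendsto_of_tendsto_of_tendsto_of_le_of_le tendsto_const_nhds h4 (fun _ => bot_le)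
    fun n => ?_
  dsimp only
  rw [projOnto_sup (isClosed_map_of_bounded_below hL (hm n) hκ0 hκ1 (hκ n)), add_sub_right_comm,
    ContinuousLinearMap.add_comp, ContinuousLinearMap.comp_add]
  refine (traceNorm_add_le _ _).trans (add_le_add le_rfl ?_)
  refine (traceNorm_compress_projOnto_le _ hχ).trans ?_
  refine (hsSq_projOnto_orthoPart_comp_le _ _ hχ).trans ?_
  gcongr
  exact_mod_cast hd n

end Convergence

/-! ### Angles -/

section Angle

variable {𝓗 : Type*} [NormedAddCommGroup 𝓗] [InnerProductSpace ℂ 𝓗] [CompleteSpace 𝓗]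

/-- A positive lower bound on the angle bounds vectors by their orthogonal components. -/
theorem norm_le_of_le_subspaceAngle {α₀ : ℝ} (hα : 0 < α₀) :
    ∃ C : ℝ, 0 ≤ C ∧ ∀ S T : Submodule ℂ 𝓗, IsClosed (S : Set 𝓗) →
      (α₀ : EReal) ≤ subspaceAngle S T → ∀ v ∈ T, ‖v‖ ≤ C * ‖v - projOnto S v‖ := by
  -- Capping at `π / 2` makes `cos β` nonnegative and keeps `β` where cosine is decreasing.
  set β := min α₀ (Real.pi / 2) with hβ
  have hβ0 : 0 < β := lt_min hα (by positivity)
  have hβpi : β ≤ Real.pi := (min_le_right _ _).trans (by linarith [Real.pi_pos])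
  have hcos : Real.cos β < 1 := by
    rw [← Real.cos_zero]
    exact Real.cos_lt_cos_of_nonneg_of_le_pi le_rfl hβpi hβ0
  have hcos0 : 0 ≤ Real.cos β :=
    Real.cos_nonneg_of_mem_Icc ⟨by linarith [Real.pi_pos], min_le_right _ _⟩
  refine ⟨(1 - Real.cos β)⁻¹, inv_nonneg.2 (by linarith), fun S T hS h v hv => ?_⟩
  -- Apply the angle bound to the pair `P v`, `v`: the cosine of their angle is `‖P v‖ / ‖v‖`.
  have key : ‖projOnto S v‖ ≤ Real.cos β * ‖v‖ := by
    rcases eq_or_ne (projOnto S v) 0 with h0 | h0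
    · rw [h0, norm_zero]; positivity
    have hv0 : v ≠ 0 := by rintro rfl; simp at h0
    have h1 : (α₀ : EReal) ≤ ((Real.arccos (‖(inner ℂ (projOnto S v) v : ℂ)‖ /
        (‖projOnto S v‖ * ‖v‖)) : ℝ) : EReal) :=
      h.trans <| iInf_le_of_le _ <| iInf_le_of_le _ <| iInf_le_of_le (projOnto_mem hS v) <|
        iInf_le_of_le hv <| iInf_le_of_le h0 <| iInf_le_of_le hv0 le_rfl
    have h2 := EReal.coe_le_coe_iff.1 h1
    have hp := norm_pos_iff.2 h0
    have hp' := norm_pos_iff.2 hv0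
    rw [← inner_projOnto_projOnto, inner_self_eq_norm_sq_to_K, norm_pow, RCLike.norm_ofReal,
      abs_norm, sq, mul_div_mul_left _ _ hp.ne'] at h2
    have h3 : ‖projOnto S v‖ / ‖v‖ ≤ 1 := (div_le_one hp').2 (norm_projOnto_apply_le _ _)
    have h4 := Real.cos_le_cos_of_nonneg_of_le_pi hβ0.le (Real.arccos_le_pi _)
      ((min_le_left _ _).trans h2)
    rw [Real.cos_arccos (by linarith [show 0 ≤ ‖projOnto S v‖ / ‖v‖ by positivity]) h3] at h4
    exact (div_le_iff₀ hp').1 h4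
  rw [← div_eq_inv_mul, le_div_iff₀ (by linarith)]
  have h5 := norm_sub_norm_le v (projOnto S v)
  linarith

end Angle

/-! ### Multiplication operators -/

section MulOp

variable {E : Type*} [MeasurableSpace E] {μ : Measure E}

theorem memLp_top_ofReal {w : E → ℝ} (hw : Measurable w) (hb : ∀ x, |w x| ≤ 1) :
    MemLp (fun x => (w x : ℂ)) ∞ μ :=
  memLp_top_of_bound (Complex.measurable_ofReal.comp hw).aestronglyMeasurable 1
    (Eventually.of_forall fun x => by simpa using hb x)

theorem mulOp_ae {w : E → ℝ} (hw : Measurable w) (hb : ∀ x, |w x| ≤ 1) (f : Lp ℂ 2 μ) :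
    mulOp μ w f =ᵐ[μ] fun x => (w x : ℂ) * f x := coeFn_mulOp (memLp_top_ofReal hw hb) f

theorem isSelfAdjoint_mulOp {w : E → ℝ} (hw : Measurable w) (hb : ∀ x, |w x| ≤ 1) :
    IsSelfAdjoint (mulOp μ w) := by
  rw [ContinuousLinearMap.isSelfAdjoint_iff_isSymmetric]
  intro f h
  change inner ℂ (mulOp μ w f) h = inner ℂ f (mulOp μ w h)
  rw [L2.inner_def, L2.inner_def]
  refine integral_congr_ae ?_
  filter_upwards [mulOp_ae hw hb f, mulOp_ae hw hb h] with x h1 h2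
  rw [h1, h2]
  simp only [RCLike.inner_apply, map_mul, Complex.conj_ofReal]
  ring

theorem norm_mulOp_le_one {w : E → ℝ} (hw : Measurable w) (hb : ∀ x, |w x| ≤ 1) :
    ‖mulOp μ w‖ ≤ 1 := by
  refine ContinuousLinearMap.opNorm_le_bound _ zero_le_one fun f => ?_
  rw [one_mul]
  refine Lp.norm_le_norm_of_ae_le ?_
  filter_upwards [mulOp_ae hw hb f] with x h1
  rw [h1, norm_mul]
  refine mul_le_of_le_one_left (norm_nonneg _) ?_
  simpa using hb x

theorem mulOp_comm {w w' : E → ℝ} (hw : Measurable w) (hb : ∀ x, |w x| ≤ 1)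
    (hw' : Measurable w') (hb' : ∀ x, |w' x| ≤ 1) (f : Lp ℂ 2 μ) :
    mulOp μ w (mulOp μ w' f) = mulOp μ w' (mulOp μ w f) := by
  refine Lp.ext ?_
  filter_upwards [mulOp_ae hw hb f, mulOp_ae hw' hb' f, mulOp_ae hw hb (mulOp μ w' f),
    mulOp_ae hw' hb' (mulOp μ w f)] with x h1 h2 h3 h4
  rw [h3, h4, h1, h2]
  ring

theorem tendsto_mulOp_apply {w : ℕ → E → ℝ} (hw : ∀ n, Measurable (w n))
    (hb : ∀ n x, |w n x| ≤ 1) (ht : ∀ x, Tendsto (fun n => w n x) atTop (𝓝 1)) (f : Lp ℂ 2 μ) :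
    Tendsto (fun n => mulOp μ (w n) f) atTop (𝓝 f) := by
  rw [tendsto_iff_norm_sub_tendsto_zero]
  have hae (n) : mulOp μ (w n) f - f =ᵐ[μ] fun x => ((w n x : ℂ) - 1) * f x := by
    filter_upwards [mulOp_ae (hw n) (hb n) f, Lp.coeFn_sub (mulOp μ (w n) f) f] with x h1 h2
    rw [h2, Pi.sub_apply, h1]
    ring
  -- The squared norm is an integral, to which dominated convergence applies with bound `4 ‖f‖²`.
  have h1 : Tendsto (fun n => inner ℂ (mulOp μ (w n) f - f) (mulOp μ (w n) f - f)) atTop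
      (𝓝 (0 : ℂ)) := by
    simp_rw [L2.inner_def]
    rw [← integral_zero E ℂ (μ := μ)]
    refine tendsto_integral_of_dominated_convergence (fun x => 4 * ‖f x‖ ^ 2)
      (fun n => (L2.integrable_inner _ _).aestronglyMeasurable) ?_ (fun n => ?_) ?_
    · exact ((Lp.memLp f).integrable_norm_pow (by norm_num)).const_mul 4
    · filter_upwards [hae n] with x h
      rw [h, inner_self_eq_norm_sq_to_K, norm_pow, RCLike.norm_ofReal, abs_norm, norm_mul, mul_pow]
      gcongr
      have h2 : ‖(w n x : ℂ) - 1‖ ≤ 2 := by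
        refine (norm_sub_le _ _).trans ?_
        have := hb n x
        rw [Complex.norm_real, Real.norm_eq_abs, norm_one]
        linarith
      calc ‖(w n x : ℂ) - 1‖ ^ 2 ≤ 2 ^ 2 := by gcongr
        _ = 4 := by norm_num
    · filter_upwards [ae_all_iff.2 hae] with x h
      simp_rw [h]
      have h2 : Tendsto (fun n => ((w n x : ℂ) - 1) * f x) atTop (𝓝 ((1 - 1) * f x)) :=
        (((Complex.continuous_ofReal.tendsto 1).comp (ht x)).sub_const 1).mul_const _
      simpa using h2.inner (𝕜 := ℂ) h2
  have h2 := (Real.continuous_sqrt.tendsto _).comp h1.norm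
  simpa [Function.comp_def, inner_self_eq_norm_sq_to_K] using h2

omit [MeasurableSpace E] in
theorem sqrt_chi (B : Set E) : (fun x => Real.sqrt (chi B x)) = chi B := by
  ext x
  by_cases h : x ∈ B <;> simp [chi, h]

theorem measurable_chi {B : Set E} (hB : MeasurableSet B) : Measurable (chi B) :=
  measurable_one.indicator hB

omit [MeasurableSpace E] in
theorem abs_chi_le (B : Set E) (x : E) : |chi B x| ≤ 1 := by
  by_cases h : x ∈ B <;> simp [chi, h]

theorem compress_chi (B : Set E) (K : Lp ℂ 2 μ →L[ℂ] Lp ℂ 2 μ) :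
    compress μ (chi B) K = mulOp μ (chi B) ∘L K ∘L mulOp μ (chi B) := by
  rw [compress, sqrt_chi]

theorem hsSq_projOnto_comp_chi {L : Submodule ℂ (Lp ℂ 2 μ)} {B : Set E} (hB : MeasurableSet B)
    (h : IsTraceClass (compress μ (chi B) (projOnto L))) :
    hsSq (projOnto L ∘L mulOp μ (chi B)) ≠ ∞ := by
  rw [IsTraceClass, compress_chi] at h
  exact ((hsSq_le_traceNorm_compress_projOnto L
    (isSelfAdjoint_mulOp (measurable_chi hB) (abs_chi_le B))).trans_lt h).ne

end MulOp

/-! ### Weighted subspaces and the coordinates of `V` -/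

section Spaces

variable {E : Type*} [MeasurableSpace E] {μ : Measure E}

theorem coeFn_sum_smul {d : ℕ} (c : Fin d → ℂ) (b : Fin d → (E →ₘ[μ] ℂ)) :
    ⇑(∑ j, c j • b j : E →ₘ[μ] ℂ) =ᵐ[μ] fun x => ∑ j, c j * b j x := by
  have h1 : ∀ᵐ x ∂μ, ∀ j, (c j • b j : E →ₘ[μ] ℂ) x = c j * b j x :=
    ae_all_iff.2 fun j => by
      filter_upwards [AEEqFun.coeFn_smul (c j) (b j)] with x h using by simp [h]
  filter_upwards [h1, AEEqFun.coeFn_finsetSum Finset.univ (fun j => c j • b j)] with x h2 h3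
  rw [h3, Finset.sum_apply]
  exact Finset.sum_congr rfl fun j _ => h2 j

/-- For a bounded weight, `√w L` is the image of `L` under multiplication by `√w`. -/
theorem sqrtMul_map_inclL2 {w : E → ℝ} (hw : Measurable fun x => Real.sqrt (w x))
    (hb : ∀ x, |Real.sqrt (w x)| ≤ 1) (L : Submodule ℂ (Lp ℂ 2 μ)) :
    sqrtMul w (L.map (inclL2 μ)) =
      L.map (mulOp μ (fun x => Real.sqrt (w x)) : Lp ℂ 2 μ →ₗ[ℂ] Lp ℂ 2 μ) := by
  ext f
  constructor
  · rintro ⟨_, ⟨l, hl, rfl⟩, h⟩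
    refine ⟨l, hl, Lp.ext ?_⟩
    exact (mulOp_ae hw hb l).trans h.symm
  · rintro ⟨l, hl, rfl⟩
    exact ⟨_, ⟨l, hl, rfl⟩, mulOp_ae hw hb l⟩

/-- `sqrtMul` keeps only products lying in `L₂`. If `√w (h + v)` lies there, then `hV` ensures that
`√w h` does as well. -/
theorem sqrtMul_sup {w : E → ℝ} (H V : Submodule ℂ (E →ₘ[μ] ℂ))
    (hV : ∀ v ∈ V, MemLp (fun x => (Real.sqrt (w x) : ℂ) * v x) 2 μ) :
    sqrtMul w (H ⊔ V) = sqrtMul w H ⊔ sqrtMul w V := by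
  refine le_antisymm ?_ (sup_le ?_ ?_)
  · rintro f ⟨k, hk, hf⟩
    obtain ⟨h, hh, v, hv, rfl⟩ := Submodule.mem_sup.1 hk
    refine Submodule.mem_sup.2 ⟨f - (hV v hv).toLp, ⟨h, hh, ?_⟩, (hV v hv).toLp,
      ⟨v, hv, (hV v hv).coeFn_toLp⟩, sub_add_cancel _ _⟩
    filter_upwards [hf, (hV v hv).coeFn_toLp, Lp.coeFn_sub f (hV v hv).toLp,
      AEEqFun.coeFn_add h v] with x h1 h2 h3 h4
    rw [h3, Pi.sub_apply, h1, h2, h4, Pi.add_apply]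
    ring
  · rintro f ⟨h, hh, hf⟩
    exact ⟨h, Submodule.mem_sup_left hh, hf⟩
  · rintro f ⟨h, hh, hf⟩
    exact ⟨h, Submodule.mem_sup_right hh, hf⟩

/-- Multiplication by `√w`, as a linear map on a space `V` with `√w V ⊂ L₂`. -/
noncomputable def sqrtMulMap {w : E → ℝ} {V : Submodule ℂ (E →ₘ[μ] ℂ)}
    (hV : ∀ v ∈ V, MemLp (fun x => (Real.sqrt (w x) : ℂ) * v x) 2 μ) : V →ₗ[ℂ] Lp ℂ 2 μ where
  toFun v := (hV v v.2).toLp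
  map_add' u v := by
    rw [← MemLp.toLp_add, MemLp.toLp_eq_toLp_iff]
    filter_upwards [AEEqFun.coeFn_add (u : E →ₘ[μ] ℂ) v] with x h
    simp only [Submodule.coe_add, h, Pi.add_apply]
    ring
  map_smul' c v := by
    rw [RingHom.id_apply, ← MemLp.toLp_const_smul, MemLp.toLp_eq_toLp_iff]
    filter_upwards [AEEqFun.coeFn_smul c (v : E →ₘ[μ] ℂ)] with x h
    simp only [Submodule.coe_smul, h, Pi.smul_apply, smul_eq_mul]
    ring

theorem range_sqrtMulMap {w : E → ℝ} {V : Submodule ℂ (E →ₘ[μ] ℂ)}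
    (hV : ∀ v ∈ V, MemLp (fun x => (Real.sqrt (w x) : ℂ) * v x) 2 μ) :
    LinearMap.range (sqrtMulMap hV) = sqrtMul w V := by
  ext f
  constructor
  · rintro ⟨v, rfl⟩
    exact ⟨v, v.2, (hV v v.2).coeFn_toLp⟩
  · rintro ⟨v, hv, h⟩
    exact ⟨⟨v, hv⟩, Lp.ext ((hV v hv).coeFn_toLp.trans h.symm)⟩

/-- If no nonzero combination of the `b j` is square integrable, weights `w n → 1` force the
coefficients of combinations with bounded weighted norms to tend to zero. -/
theorem tendsto_coeff_zero {d : ℕ} {b : Fin d → (E →ₘ[μ] ℂ)}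
    (hb : ∀ a : Fin d → ℂ, MemLp (fun x => ∑ j, a j * b j x) 2 μ → a = 0)
    {w : ℕ → E → ℝ} (hw : ∀ n, Measurable (w n))
    (ht : ∀ x, Tendsto (fun n => w n x) atTop (𝓝 1)) {c : ℕ → Fin d → ℂ} {C : ℝ}
    (hc : ∀ n, eLpNorm (fun x => (w n x : ℂ) * ∑ j, c n j * b j x) 2 μ ≤ ENNReal.ofReal C) :
    Tendsto c atTop (𝓝 0) := by
  by_contra hcon
  rw [Metric.tendsto_atTop] at hcon
  push Not at hcon
  obtain ⟨ε, hε, hfreq⟩ := hcon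
  obtain ⟨φ, hφ, hφε⟩ := extraction_of_frequently_atTop (frequently_atTop.2 hfreq)
  simp only [dist_zero_right] at hφε
  -- Along a subsequence with `‖c‖ ≥ ε`, normalize and pass to a limit `a` on the unit sphere. The
  -- weighted norms stay below `C / ε`, so by Fatou the combination with coefficients `a` is square
  -- integrable, forcing `a = 0`.
  let u (k : ℕ) : Fin d → ℂ := (‖c (φ k)‖⁻¹ : ℂ) • c (φ k)
  have hu (k) : u k ∈ Metric.sphere (0 : Fin d → ℂ) 1 := by
    have : ‖c (φ k)‖ ≠ 0 := (hε.trans_le (hφε k)).ne'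
    simp [u, norm_smul, this]
  obtain ⟨a, ha, ψ, hψ, hψa⟩ := (isCompact_sphere (0 : Fin d → ℂ) 1).tendsto_subseq hu
  have ha0 : a = 0 := by
    refine hb a ⟨?_, ?_⟩
    · exact Finset.aestronglyMeasurable_fun_sum _ fun j _ => (b j).aestronglyMeasurable.const_mul _
    let F (k : ℕ) (x : E) : ℂ := (w (φ (ψ k)) x : ℂ) * ∑ j, u (ψ k) j * b j x
    have hF (k) : AEStronglyMeasurable (F k) μ :=
      (Complex.measurable_ofReal.comp (hw _)).aestronglyMeasurable.mul
        (Finset.aestronglyMeasurable_fun_sum _ fun j _ => (b j).aestronglyMeasurable.const_mul _)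
    have hlim (x) : Tendsto (fun k => F k x) atTop (𝓝 (∑ j, a j * b j x)) := by
      have h1 : Tendsto (fun k => (w (φ (ψ k)) x : ℂ)) atTop (𝓝 1) :=
        (Complex.continuous_ofReal.tendsto 1).comp
          ((ht x).comp (hφ.tendsto_atTop.comp hψ.tendsto_atTop))
      have h2 : Tendsto (fun k => ∑ j, u (ψ k) j * b j x) atTop (𝓝 (∑ j, a j * b j x)) :=
        tendsto_finsetSum _ fun j _ => ((tendsto_pi_nhds.1 hψa) j).mul_const _
      simpa using h1.mul h2
    have hbd (k) : eLpNorm (F k) 2 μ ≤ ENNReal.ofReal (ε⁻¹ * C) := by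
      have hpos := hε.trans_le (hφε (ψ k))
      have e : F k = (‖c (φ (ψ k))‖⁻¹ : ℂ) •
          fun x => (w (φ (ψ k)) x : ℂ) * ∑ j, c (φ (ψ k)) j * b j x := by
        ext x
        simp only [F, u, Pi.smul_apply, smul_eq_mul, mul_assoc, ← Finset.mul_sum]
        ring
      rw [e, eLpNorm_const_smul, ENNReal.ofReal_mul (by positivity)]
      refine mul_le_mul' ?_ (hc _)
      rw [← ofReal_norm]
      refine ENNReal.ofReal_le_ofReal ?_
      rw [norm_inv, Complex.norm_real, norm_norm]
      exact inv_anti₀ hε (hφε _)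
    refine (Lp.eLpNorm_lim_le_liminf_eLpNorm hF _ (Eventually.of_forall hlim)).trans_lt ?_
    refine (liminf_le_of_le (by isBoundedDefault) (fun B hB => ?_)).trans_lt
      (ENNReal.ofReal_lt_top (r := ε⁻¹ * C))
    obtain ⟨k, hk⟩ := hB.exists
    exact hk.trans (hbd k)
  simp [ha0] at ha

theorem exists_coordinates (V : Submodule ℂ (E →ₘ[μ] ℂ)) [FiniteDimensional ℂ V] :
    ∃ (d : ℕ) (b : Fin d → (E →ₘ[μ] ℂ)), (∀ j, b j ∈ V) ∧
      (∀ v ∈ V, ∃ a : Fin d → ℂ, v = ∑ j, a j • b j) ∧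
      ∀ a : Fin d → ℂ, ∑ j, a j • b j = 0 → a = 0 := by
  have : Module.Free ℂ V := Module.Free.of_divisionRing ℂ V
  let b := Module.finBasis ℂ V
  refine ⟨_, fun j => (b j : E →ₘ[μ] ℂ), fun j => (b j).2, fun v hv => ⟨b.repr ⟨v, hv⟩, ?_⟩,
    fun a ha => ?_⟩
  · have := congrArg V.subtype (b.sum_repr ⟨v, hv⟩)
    rw [map_sum] at this
    exact this.symm
  · have h2 : ∑ j, a j • b j = 0 := V.subtype_injective (by rw [map_sum, map_zero]; exact ha)
    have h3 := b.repr_sum_self a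
    rw [h2, map_zero] at h3
    exact h3.symm

/-- If `V ∩ L₂ = 0` and `w n → 1`, bounded sequences in `√(w n) V` vanish locally in the limit. -/
theorem tendsto_mulOp_chi_zero {V : Submodule ℂ (E →ₘ[μ] ℂ)} [FiniteDimensional ℂ V]
    (hV : ∀ v ∈ V, MemLp v 2 μ → v = 0) {g : ℕ → E → ℝ}
    (hw : ∀ n, Measurable fun x => Real.sqrt (g n x)) (hb : ∀ n x, |Real.sqrt (g n x)| ≤ 1)
    (hwt : ∀ x, Tendsto (fun n => Real.sqrt (g n x)) atTop (𝓝 1))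
    {v : ℕ → Lp ℂ 2 μ} (hv : ∀ n, v n ∈ sqrtMul (g n) V) {C : ℝ} (hvC : ∀ n, ‖v n‖ ≤ C)
    {B : Set E} (hB : MeasurableSet B) (hVB : ∀ u ∈ V, MemLp u 2 (μ.restrict B)) :
    Tendsto (fun n => mulOp μ (chi B) (v n)) atTop (𝓝 0) := by
  choose φ hφ hvφ using hv
  obtain ⟨d, b, hbV, hspan, hind⟩ := exists_coordinates V
  choose co hφsum using fun n => hspan (φ n) (hφ n)
  have hvae (n) : v n =ᵐ[μ] fun x => (Real.sqrt (g n x) : ℂ) * ∑ j, co n j * b j x := by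
    have := coeFn_sum_smul (co n) b
    rw [← hφsum] at this
    filter_upwards [hvφ n, this] with x h1 h2
    rw [h1, h2]
  have hco : Tendsto co atTop (𝓝 0) := by
    refine tendsto_coeff_zero (b := b) (fun a ha => ?_) hw hwt (C := C) (fun n => ?_)
    · exact hind a (hV _ (Submodule.sum_mem _ fun j _ => V.smul_mem _ (hbV j))
        ((memLp_congr_ae (coeFn_sum_smul a b)).2 ha))
    · rw [← eLpNorm_congr_ae (hvae n), ← Lp.enorm_def, ← ofReal_norm]
      exact ENNReal.ofReal_le_ofReal (hvC n)
  have hβ (j) : MemLp (B.indicator (b j)) 2 μ := (memLp_indicator_iff_restrict hB).2 (hVB _ (hbV j))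
  let β (j) : Lp ℂ 2 μ := (hβ j).toLp
  -- `χ_B v n` is `√(g n)` times this combination of the fixed `L₂` functions `χ_B b j`.
  have h0 : Tendsto (fun n => ∑ j, co n j • β j) atTop (𝓝 0) := by
    have := tendsto_finsetSum Finset.univ fun j (_ : j ∈ Finset.univ) =>
      ((tendsto_pi_nhds.1 hco) j).smul_const (β j)
    simpa using this
  refine (tendsto_apply_of_bounded (fun n => norm_mulOp_le_one (hw n) (hb n)) h0).congr
    fun n => Lp.ext ?_
  have h2 : ∀ᵐ x ∂μ, ∀ j, β j x = B.indicator (b j) x :=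
    ae_all_iff.2 fun j => (hβ j).coeFn_toLp
  have h3 : ∀ᵐ x ∂μ, ∀ j, (co n j • β j : Lp ℂ 2 μ) x = co n j * β j x :=
    ae_all_iff.2 fun j => by
      filter_upwards [Lp.coeFn_smul (co n j) (β j)] with x h using by simp [h]
  filter_upwards [mulOp_ae (hw n) (hb n) (∑ j, co n j • β j), h2, h3, hvae n,
    Lp.coeFn_fun_finsetSum Finset.univ (fun j => co n j • β j),
    mulOp_ae (measurable_chi hB) (abs_chi_le B) (v n)] with x e1 e2 e3 e4 e5 e6
  rw [e1, e5, e6, e4]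
  simp only [e3, e2]
  by_cases hx : x ∈ B <;> simp [chi, hx]

end Spaces

/-- Split `⟨h, v n⟩ = ⟨h, χ k (v n)⟩ - ⟨χ k h - h, v n⟩`: first fix `k` to make the second term
small uniformly in `n`, then let `n` grow. -/
theorem tendsto_inner_zero_of_approx {𝓗 : Type*} [NormedAddCommGroup 𝓗] [InnerProductSpace ℂ 𝓗]
    [CompleteSpace 𝓗] {χ : ℕ → 𝓗 →L[ℂ] 𝓗} (hχ : ∀ k, IsSelfAdjoint (χ k)) {h : 𝓗}
    (hh : Tendsto (fun k => χ k h) atTop (𝓝 h)) {v : ℕ → 𝓗} {C : ℝ} (hC : ∀ n, ‖v n‖ ≤ C)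
    (hv : ∀ k, Tendsto (fun n => χ k (v n)) atTop (𝓝 0)) :
    Tendsto (fun n => inner ℂ h (v n)) atTop (𝓝 0) := by
  have hC0 : 0 ≤ C := (norm_nonneg _).trans (hC 0)
  rw [Metric.tendsto_atTop]
  intro ε hε
  have h1 := (tendsto_iff_norm_sub_tendsto_zero.1 hh).mul_const C
  rw [zero_mul] at h1
  obtain ⟨k, hk⟩ := (h1.eventually (gt_mem_nhds (half_pos hε))).exists
  have h2 : Tendsto (fun n => ‖inner ℂ h (χ k (v n))‖) atTop (𝓝 0) := by
    simpa using ((tendsto_const_nhds (x := h)).inner (𝕜 := ℂ) (hv k)).norm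
  obtain ⟨N, hN⟩ := eventually_atTop.1 (h2.eventually (gt_mem_nhds (half_pos hε)))
  refine ⟨N, fun n hn => ?_⟩
  rw [dist_zero_right]
  have e : inner ℂ h (v n) = inner ℂ h (χ k (v n)) - inner ℂ (χ k h - h) (v n) := by
    rw [inner_sub_left, inner_left_eq_right (hχ k)]; ring
  rw [e]
  have h3 : ‖inner ℂ (χ k h - h) (v n)‖ ≤ ‖χ k h - h‖ * C :=
    (norm_inner_le_norm _ _).trans (mul_le_mul_of_nonneg_left (hC n) (norm_nonneg _))
  linarith [norm_sub_le (inner ℂ h (χ k (v n))) (inner ℂ (χ k h - h) (v n)), hN n hn]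

/-! ### The common form of the Proposition and the Corollary -/

section Main

variable {E : Type*} [MetricSpace E] [MeasurableSpace E] {μ : Measure E}
  {L : Submodule ℂ (Lp ℂ 2 μ)} {V : Submodule ℂ (E →ₘ[μ] ℂ)} {E₀ : Set E}

/-- Restriction to `E₀` is bounded below on `L`. -/
theorem StandingAssumption.exists_norm_le (hLV : StandingAssumption L V E₀) :
    ∃ K : ℝ, 0 < K ∧ ∀ f ∈ L, ‖f‖ ≤ K * ‖mulOp μ (chi E₀) f‖ := by
  have hm := hLV.measurableSet
  have hmc := hm.compl
  have hsa := isSelfAdjoint_mulOp (μ := μ) (measurable_chi hmc) (abs_chi_le E₀ᶜ)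
  have hhs := hsSq_projOnto_comp_chi hmc hLV.traceClass_compl
  rw [← hsSq_comp_eq_of_selfAdjoint hsa (isSelfAdjoint_projOnto L)] at hhs
  -- If `χ_{E₀ᶜ} Q f = f`, then `‖Q f‖ = ‖f‖`, so `f ∈ L` and `f` vanishes on `E₀`; condition (d)
  -- gives `f = 0`.
  have hev : ¬ Module.End.HasEigenvalue
      ((mulOp μ (chi E₀ᶜ) ∘L projOnto L : Lp ℂ 2 μ →L[ℂ] Lp ℂ 2 μ) :
        Module.End ℂ (Lp ℂ 2 μ)) 1 := by
    intro hev
    obtain ⟨f, hf⟩ := hev.exists_hasEigenvector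
    have hf1 : mulOp μ (chi E₀ᶜ) (projOnto L f) = f := by
      simpa using hf.apply_eq_smul
    have hn : ‖projOnto L f‖ = ‖f‖ := by
      refine le_antisymm (norm_projOnto_apply_le _ _) ?_
      conv_lhs => rw [← hf1]
      simpa using (mulOp μ (chi E₀ᶜ)).le_of_opNorm_le
        (norm_mulOp_le_one (measurable_chi hmc) (abs_chi_le E₀ᶜ)) (projOnto L f)
    have hfL : f ∈ L.topologicalClosure :=
      (Submodule.mem_iff_norm_starProjection _ _).2 hn
    rw [hLV.isClosed.submodule_topologicalClosure_eq] at hfL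
    rw [projOnto_of_mem hfL] at hf1
    refine hf.2 (hLV.eq_zero_of_mem_L f hfL ?_)
    filter_upwards [mulOp_ae (measurable_chi hmc) (abs_chi_le E₀ᶜ) f] with x hx hxE
    rw [hf1] at hx
    rw [hx]
    simp [chi, hxE]
  -- By compactness `χ_{E₀ᶜ} Q - 1` is bounded below; on `L` it equals `-χ_{E₀}`.
  obtain ⟨K, hK⟩ := IsCompactOperator.antilipschitz_of_not_hasEigenvalue
    (isCompactOperator_of_hsSq hhs) one_ne_zero hev
  refine ⟨K + 1, by positivity, fun f hf => ?_⟩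
  have h1 := hK.le_mul_dist f 0
  have h2 : (mulOp μ (chi E₀ᶜ) ∘L projOnto L - (1 : ℂ) • (1 : Lp ℂ 2 μ →L[ℂ] Lp ℂ 2 μ)) f =
      - mulOp μ (chi E₀) f := by
    simp only [sub_apply, ContinuousLinearMap.comp_apply, projOnto_of_mem hf, one_smul,
      one_apply_eq_self]
    refine Lp.ext ?_
    filter_upwards [mulOp_ae (measurable_chi hmc) (abs_chi_le E₀ᶜ) f,
      mulOp_ae (measurable_chi hm) (abs_chi_le E₀) f, Lp.coeFn_neg (mulOp μ (chi E₀) f),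
      Lp.coeFn_sub (mulOp μ (chi E₀ᶜ) f) f] with x a b c d
    rw [d, Pi.sub_apply, c, Pi.neg_apply, a, b]
    by_cases h : x ∈ E₀ <;> simp [chi, h]
  rw [map_zero, dist_zero_right, dist_zero_right, h2, norm_neg] at h1
  refine h1.trans (mul_le_mul_of_nonneg_right (by simp) (norm_nonneg _))

/-- The common form of both parts: weights `g n → 1` pointwise, bounded below on `E₀` uniformly
in `n`, with a uniform lower bound on the angle between `√(g n) L` and `√(g n) V`. -/
theorem tendstoLocTraceClass_of_tendsto_one [BorelSpace E] (hLV : StandingAssumption L V E₀)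
    (hV : ∀ v ∈ V, MemLp v 2 μ → v = 0) {g : ℕ → E → ℝ} (hg : ∀ n, Measurable (g n))
    (hg1 : ∀ n x, g n x ≤ 1)
    (hgt : ∀ x, Tendsto (fun n => g n x) atTop (𝓝 1)) {c : ℝ} (hc0 : 0 < c)
    (hc : ∀ n, ∀ x ∈ E₀, c ≤ g n x)
    (hgV : ∀ n, ∀ v ∈ V, MemLp (fun x => (Real.sqrt (g n x) : ℂ) * v x) 2 μ)
    {α₀ : ℝ} (hα : 0 < α₀)
    (hangle : ∀ n, (α₀ : EReal) ≤
      subspaceAngle (sqrtMul (g n) (L.map (inclL2 μ))) (sqrtMul (g n) V)) :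
    (∀ n, IsClosed (sqrtMul (g n) (L.map (inclL2 μ) ⊔ V) : Set (Lp ℂ 2 μ))) ∧
      TendstoLocTraceClass
        (fun n => projOnto (sqrtMul (g n) (L.map (inclL2 μ) ⊔ V))) (projOnto L) := by
  have hw (n) : Measurable fun x => Real.sqrt (g n x) := (hg n).sqrt
  have hb (n x) : |Real.sqrt (g n x)| ≤ 1 := by
    rw [abs_of_nonneg (Real.sqrt_nonneg _)]
    exact Real.sqrt_le_one.2 (hg1 n x)
  have hwt (x) : Tendsto (fun n => Real.sqrt (g n x)) atTop (𝓝 1) := by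
    simpa [Function.comp_def] using (Real.continuous_sqrt.tendsto 1).comp (hgt x)
  set m : ℕ → Lp ℂ 2 μ →L[ℂ] Lp ℂ 2 μ := fun n => mulOp μ fun x => Real.sqrt (g n x) with hm
  have hmsa (n) : IsSelfAdjoint (m n) := isSelfAdjoint_mulOp (hw n) (hb n)
  have hm1 (n) : ‖m n‖ ≤ 1 := norm_mulOp_le_one (hw n) (hb n)
  have hmt (f : Lp ℂ 2 μ) : Tendsto (fun n => m n f) atTop (𝓝 f) := tendsto_mulOp_apply hw hb hwt f
  have hmχ {B : Set E} (hB : MeasurableSet B) (n) (f : Lp ℂ 2 μ) :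
      mulOp μ (chi B) (m n f) = m n (mulOp μ (chi B) f) :=
    mulOp_comm (measurable_chi hB) (abs_chi_le B) (hw n) (hb n) f
  have hmap (n) : sqrtMul (g n) (L.map (inclL2 μ)) =
    L.map (m n : Lp ℂ 2 μ →ₗ[ℂ] Lp ℂ 2 μ) := sqrtMul_map_inclL2 (hw n) (hb n) L
  have hsup (n) : sqrtMul (g n) (L.map (inclL2 μ) ⊔ V) =
      L.map (m n : Lp ℂ 2 μ →ₗ[ℂ] Lp ℂ 2 μ) ⊔ sqrtMul (g n) V := by
    rw [sqrtMul_sup _ _ (hgV n), hmap]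
  obtain ⟨κ, hκ0, hκ1, hκ⟩ : ∃ κ : ℝ, 0 < κ ∧ κ ≤ 1 ∧ ∀ n, ∀ f ∈ L, κ * ‖f‖ ≤ ‖m n f‖ := by
    obtain ⟨K, hK0, hK⟩ := hLV.exists_norm_le
    have hs : 0 < Real.sqrt c := Real.sqrt_pos.2 hc0
    -- On `E₀` the weight `√(g n)` is at least `√c`, and restriction to `E₀` loses at most the
    -- factor `K` on `L`.
    refine ⟨min 1 (Real.sqrt c / K), lt_min one_pos (by positivity), min_le_left _ _,
      fun n f hf => ?_⟩
    have h1 : ‖mulOp μ (chi E₀) f‖ ≤ (Real.sqrt c)⁻¹ * ‖m n f‖ := by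
      refine Lp.norm_le_mul_norm_of_ae_le_mul ?_
      filter_upwards [mulOp_ae (measurable_chi hLV.measurableSet) (abs_chi_le E₀) f,
        mulOp_ae (hw n) (hb n) f] with x h1 h2
      rw [h1, hm, h2, norm_mul, norm_mul, ← div_eq_inv_mul, le_div_iff₀ hs]
      by_cases hx : x ∈ E₀
      · have := Real.sqrt_le_sqrt (hc n x hx)
        simp only [chi, hx, Set.indicator_of_mem, Pi.one_apply, Complex.norm_real,
          Real.norm_of_nonneg (Real.sqrt_nonneg _), norm_one, one_mul]
        rw [mul_comm]
        gcongr
      · simp only [chi, hx, not_false_eq_true, Set.indicator_of_notMem, Complex.ofReal_zero,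
          norm_zero, zero_mul]
        positivity
    calc min 1 (Real.sqrt c / K) * ‖f‖ ≤ Real.sqrt c / K * (K * ‖mulOp μ (chi E₀) f‖) := by
          gcongr
          · exact min_le_right _ _
          · exact hK f hf
      _ = Real.sqrt c * ‖mulOp μ (chi E₀) f‖ := by field_simp
      _ ≤ Real.sqrt c * ((Real.sqrt c)⁻¹ * ‖m n f‖) := by gcongr
      _ = ‖m n f‖ := by field_simp
  have hVfin := hLV.finiteDimensional
  have hVn (n) : FiniteDimensional ℂ (sqrtMul (g n) V) := by
    rw [← range_sqrtMulMap (hgV n)]; infer_instance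
  have hVd (n) : Module.finrank ℂ (sqrtMul (g n) V) ≤ Module.finrank ℂ V := by
    rw [← range_sqrtMulMap (hgV n)]; exact LinearMap.finrank_range_le _
  have hLcl (n) := isClosed_map_of_bounded_below hLV.isClosed (hmsa n) hκ0 hκ1 (hκ n)
  have hloctr (B : Set E) (hB : MeasurableSet B) (hBb : Bornology.IsBounded B) :=
    hsSq_projOnto_comp_chi hB (hLV.locTraceClass B hB hBb)
  obtain ⟨C, hC0, hC⟩ := norm_le_of_le_subspaceAngle (𝓗 := Lp ℂ 2 μ) hα
  have hCn (n) : ∀ v ∈ sqrtMul (g n) V,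
      ‖v‖ ≤ C * ‖v - projOnto (L.map (m n : Lp ℂ 2 μ →ₗ[ℂ] Lp ℂ 2 μ)) v‖ :=
    hC _ _ (hLcl n) (hmap n ▸ hangle n)
  have hloc (B : Set E) (hB : MeasurableSet B) (hBb : Bornology.IsBounded B)
      (v : ℕ → Lp ℂ 2 μ) (hv : ∀ n, v n ∈ sqrtMul (g n) V) (hvC : ∀ n, ‖v n‖ ≤ C) :
      Tendsto (fun n => mulOp μ (chi B) (v n)) atTop (𝓝 0) :=
    tendsto_mulOp_chi_zero hV hw hb hwt hv hvC hB fun u hu => hLV.memL2loc u hu B hB hBb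
  have hweak (v : ℕ → Lp ℂ 2 μ) (hv : ∀ n, v n ∈ sqrtMul (g n) V) (hvC : ∀ n, ‖v n‖ ≤ C)
      (h : Lp ℂ 2 μ) : Tendsto (fun n => inner ℂ h (v n)) atTop (𝓝 0) := by
    rcases isEmpty_or_nonempty E with hE | ⟨⟨x₀⟩⟩
    · have : h = 0 := Lp.ext (Eventually.of_forall isEmptyElim)
      simp [this]
    -- Cutting off to balls exhausting `E` reduces weak convergence to local norm convergence.
    let χ (k : ℕ) := mulOp μ (chi (Metric.ball x₀ (k : ℝ)))
    have hball (k : ℕ) : MeasurableSet (Metric.ball x₀ (k : ℝ)) := measurableSet_ball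
    refine tendsto_inner_zero_of_approx (χ := χ)
      (fun k => isSelfAdjoint_mulOp (measurable_chi (hball k)) (abs_chi_le _)) ?_ hvC
      (fun k => hloc _ (hball k) Metric.isBounded_ball v hv hvC)
    refine tendsto_mulOp_apply (fun k => measurable_chi (hball k)) (fun k => abs_chi_le _)
      (fun x => ?_) h
    obtain ⟨k₀, hk₀⟩ := exists_nat_gt (dist x x₀)
    refine tendsto_const_nhds.congr' ?_
    filter_upwards [eventually_ge_atTop k₀] with k hk
    have : x ∈ Metric.ball x₀ (k : ℝ) :=
      Metric.mem_ball.2 (hk₀.trans_le (by exact_mod_cast hk))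
    simp [chi, this]
  refine ⟨fun n => ?_, ⟨fun n B hB hBb => ?_, hLV.locTraceClass, fun B hB hBb => ?_⟩⟩
  · rw [hsup]
    exact Submodule.isClosed_sup_finiteDimensional _ _ (hLcl n)
  · rw [IsTraceClass, compress_chi, hsup]
    exact traceNorm_compress_projOnto_sup_lt_top hLV.isClosed (hmsa n) hκ0 hκ1 (hκ n)
      (isSelfAdjoint_mulOp (measurable_chi hB) (abs_chi_le B)) (hmχ hB n) (hloctr B hB hBb)
  · simp_rw [compress_chi, hsup]
    exact tendsto_traceNorm_projOnto_sup hLV.isClosed hmsa hm1 hmt hκ0 hκ1 hκ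
      (isSelfAdjoint_mulOp (measurable_chi hB) (abs_chi_le B)) (hmχ hB) (hloctr B hB hBb)
      hC0 hCn hweak (hloc B hB hBb) hVd

end Main

end InfDet

theorem proposition2p6 {E : Type*} [MetricSpace E] [MeasurableSpace E] [BorelSpace E]
    (μ : Measure E) [SigmaFinite μ]
    (L : Submodule ℂ (Lp ℂ 2 μ)) (V : Submodule ℂ (E →ₘ[μ] ℂ)) (E₀ : Set E)
    (hLV : InfDet.StandingAssumption L V E₀)
    (hV : ∀ v ∈ V, MemLp v 2 μ → v = 0) :
    (∀ g : ℕ → E → ℝ,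
      (∀ n, Measurable (g n)) →
      (∀ n x, 0 < g n x ∧ g n x ≤ 1) →
      (∀ n, InfDet.IsTraceClass
        (InfDet.compress μ (fun x => 1 - g n x) (InfDet.projOnto L))) →
      (∀ n, ∀ v ∈ V, MemLp (fun x => (Real.sqrt (g n x) : ℂ) * v x) 2 μ) →
      (∃ α₀ : ℝ, 0 < α₀ ∧ ∀ n, (α₀ : EReal) ≤
        InfDet.subspaceAngle (InfDet.sqrtMul (g n) (L.map (InfDet.inclL2 μ)))
          (InfDet.sqrtMul (g n) V)) →
      (∀ B : Set E, Bornology.IsBounded B →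
        (∃ c : ℝ, 0 < c ∧ ∀ n, ∀ x ∈ E₀ ∪ B, c ≤ g n x) ∧
        TendstoUniformlyOn g (fun _ => 1) atTop (E₀ ∪ B)) →
      (∀ n, IsClosed
        (InfDet.sqrtMul (g n) (L.map (InfDet.inclL2 μ) ⊔ V) : Set (Lp ℂ 2 μ))) ∧
      InfDet.TendstoLocTraceClass
        (fun n => InfDet.projOnto (InfDet.sqrtMul (g n) (L.map (InfDet.inclL2 μ) ⊔ V)))
        (InfDet.projOnto L)) ∧
    (∀ B : ℕ → Set E,
      (∀ n, MeasurableSet (B n)) →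
      (∀ n, Bornology.IsBounded (B n)) →
      Monotone B →
      (⋃ n, B n) = E₀ᶜ →
      (∃ α₀ : ℝ, 0 < α₀ ∧ ∀ n, (α₀ : EReal) ≤
        InfDet.subspaceAngle
          (InfDet.sqrtMul (InfDet.chi (E₀ ∪ B n)) (L.map (InfDet.inclL2 μ)))
          (InfDet.sqrtMul (InfDet.chi (E₀ ∪ B n)) V)) →
      (∀ n, IsClosed
        (InfDet.sqrtMul (InfDet.chi (E₀ ∪ B n)) (L.map (InfDet.inclL2 μ) ⊔ V) :
          Set (Lp ℂ 2 μ))) ∧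
      InfDet.TendstoLocTraceClass
        (fun n => InfDet.projOnto
          (InfDet.sqrtMul (InfDet.chi (E₀ ∪ B n)) (L.map (InfDet.inclL2 μ) ⊔ V)))
        (InfDet.projOnto L)) := by

  refine ⟨fun g hg hg01 _ hgV ⟨α₀, hα, hangle⟩ hB => ?_,
    fun B hB hBb hBm hBU ⟨α₀, hα, hangle⟩ => ?_⟩
  -- The empty set yields the lower bound on `E₀`; singletons yield pointwise convergence.
  · obtain ⟨c, hc0, hc⟩ := (hB ∅ Bornology.isBounded_empty).1
    refine InfDet.tendstoLocTraceClass_of_tendsto_one hLV hV hg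
      (fun n x => (hg01 n x).2) (fun x => ?_) hc0 (fun n x hx => hc n x (Or.inl hx)) hgV hα hangle
    exact (hB {x} Bornology.isBounded_singleton).2.tendsto_at (Or.inr rfl)
  · have hm (n) : MeasurableSet (E₀ ∪ B n) := hLV.measurableSet.union (hB n)
    refine InfDet.tendstoLocTraceClass_of_tendsto_one hLV hV
      (g := fun n => InfDet.chi (E₀ ∪ B n)) (fun n => InfDet.measurable_chi (hm n))
      (fun n x => (le_abs_self _).trans (InfDet.abs_chi_le _ x)) (fun x => ?_) one_pos
      (fun n x hx => ?_) (fun n v hv => ?_) hα hangle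
    -- By exhaustion and monotonicity, the weights at `x` are eventually equal to 1.
    · obtain ⟨n₀, hn₀⟩ : ∃ n, x ∈ E₀ ∪ B n := by
        by_cases hx : x ∈ E₀
        · exact ⟨0, Or.inl hx⟩
        · obtain ⟨n, hn⟩ := Set.mem_iUnion.1 (hBU.ge hx)
          exact ⟨n, Or.inr hn⟩
      refine tendsto_const_nhds.congr' ?_
      filter_upwards [eventually_ge_atTop n₀] with n hn
      have : x ∈ E₀ ∪ B n := hn₀.imp_right fun h => hBm hn h
      simp only [InfDet.chi, Set.indicator_of_mem this, Pi.one_apply]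
    · have : x ∈ E₀ ∪ B n := Or.inl hx
      simp only [InfDet.chi, Set.indicator_of_mem this, Pi.one_apply, le_refl]
    -- Condition (b) covers `E₀`, and local square integrability covers the bounded set `B n \ E₀`.
    · have h1 : MemLp v 2 (μ.restrict (E₀ ∪ B n)) := by
        have h2 : MemLp ((E₀ ∪ B n).indicator v) 2 μ := by
          have h3 := (memLp_indicator_iff_restrict hLV.measurableSet).2 (hLV.memLp_restrict v hv)
          have h4 := (memLp_indicator_iff_restrict ((hB n).diff hLV.measurableSet)).2
            (hLV.memL2loc v hv _ ((hB n).diff hLV.measurableSet) ((hBb n).subset Set.sdiff_subset))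
          rw [← Set.union_sdiff_self, Set.indicator_union_of_disjoint Set.disjoint_sdiff_right]
          exact h3.add h4
        exact (memLp_indicator_iff_restrict (hm n)).1 h2
      refine (memLp_congr_ae (Eventually.of_forall fun x => ?_)).1
        ((memLp_indicator_iff_restrict (hm n)).2 h1)
      by_cases hx : x ∈ E₀ ∪ B n
      · simp [InfDet.chi, Set.indicator_of_mem hx]
      · simp [InfDet.chi, Set.indicator_of_notMem hx]
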